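/- **Setting.** Formulas are those of multiplicative linear logic, $A,B ::= X^+ \mid X^- \mid 1 \mid \bot \mid A\otimes B \mid A⅋B$, with the usual negation $(\cdot)^\perp$. A *typed graph* is a finite partial graph (pending edges allowed) with edges labelled by formulas and nodes labelled by rules. The edges at a node are its premises and its conclusions, typed as follows: $\mathsf{ax}$ (conclusions $X^+,X^-$), $\mathsf{cut}$ (premises $A,A^\perp$), $\otimes$ (premises $A,B$, conclusion $A\otimes B$), $⅋$ (premises $A,B$, conclusion $A⅋B$), $1$ (conclusion $1$), $\bot$ (conclusion $\bot$), weakening (conclusion $X^-$), contraction (at least two premises $X^-$, conclusion $X^-$), $\mathsf{box}$ (conclusions $Y_1^-,\dots,Y_k^-,X^+$ with $k\ge 0$ and $X\ne Y_i$ for all $i$). An edge is the conclusion of at most one node and the premise of at most one node. A *proof-net* is a typed graph in which every edge is the conclusion of some node and every (undirected) cycle uses two premises of a same $⅋$-node or of a same contraction node; its conclusions are the edges that are premise of no node. A *sub-net* of a proof-net is a subgraph that is itself a proof-net. We write $R=\mathrm{Cut}(R_1,\dots,R_n)$ for a proof-net $R$ given with a partition into sub-nets $R_1,\dots,R_n$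 and $\mathsf{cut}$-nodes, the two premises of each of these $\mathsf{cut}$-nodes being conclusions of two distinct sub-nets. It is a *cut-net* if its skeleton, the graph with vertices $R_1,\dots,R_n$ and an edge between $R_i$ and $R_j$ ($i\neq j$) exactly when there is at least one such $\mathsf{cut}$-node between $R_i$ and $R_j$, is a tree. The $\otimes/⅋$-reduction step replaces a $\mathsf{cut}$ between the conclusion of a $\otimes$-node with premises $a,b$ and the conclusion of a $⅋$-node with premises $a',b'$ by two $\mathsf{cut}$-nodes, one on $a,a'$ and one on $b,b'$ (the $\otimes$-node, the $⅋$-node and their conclusions are removed). If a proof-net $R'$ reduces to a proof-net $R$ in one such step, $R'$ is a $\otimes/⅋$-*expansion* of $R$. If $R=\mathrm{Cut}(R_1,\dots,R_n)$, an expansion *on the cuts between $R_i$ and $R_j$* is one in which the two $\mathsf{cut}$-nodes it replaces are both between $R_i$ and $R_j$; the new $\otimes$-node is added to one of $R_i,R_j$ and the new $⅋$-node to the other, and the other sub-nets are unchanged. **Theorem.** Given a cut-net $R=\mathrm{Cut}(R_1,\dots,R_n)$, there is a (finite, possibly empty) sequence of $\otimes/⅋$-expansions, each on the cuts between some pair of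 sub-nets, such that the result is a cut-net $R'=\mathrm{Cut}(R_1',\dots,R_n')$ with at most one cut between each pair $(R_i',R_j')$, $i\neq j$. -/

import Mathlib

/-- Formulas of multiplicative linear logic over a set `α` of symbols. -/
inductive MLLFormula (α : Type*) where
  | pos (X : α)
  | neg (X : α)
  | one
  | bot
  | tensor (A B : MLLFormula α)
  | par (A B : MLLFormula α)

/-- Linear negation. -/
def MLLFormula.dual {α : Type*} : MLLFormula α → MLLFormula α
  | .pos X => .neg X
  | .neg X => .pos X
  | .one => .bot
  | .bot => .one
  | .tensor A B => .par A.dual B.dual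
  | .par A B => .tensor A.dual B.dual

/-- The rules that label the nodes of a net. -/
inductive NodeLabel where
  | ax
  | cut
  | tensor
  | par
  | one
  | bot
  | weak
  | contr
  | box

/-- `NodeLabel.Typing r Γ Δ`: a node labelled `r` may have premises of types `Γ` and conclusions of
types `Δ` (each listed from left to right). -/
inductive NodeLabel.Typing {α : Type*} :
    NodeLabel → List (MLLFormula α) → List (MLLFormula α) → Prop
  | ax (X : α) : Typing .ax [] [.pos X, .neg X]
  | cut (A : MLLFormula α) : Typing .cut [A, A.dual] []
  | tensor (A B : MLLFormula α) : Typing .tensor [A, B] [.tensor A B]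
  | par (A B : MLLFormula α) : Typing .par [A, B] [.par A B]
  | one : Typing .one [] [.one]
  | bot : Typing .bot [] [.bot]
  | weak (X : α) : Typing .weak [] [.neg X]
  | contr (X : α) (k : ℕ) (hk : 2 ≤ k) : Typing .contr (List.replicate k (.neg X)) [.neg X]
  | box (X : α) (Ys : List α) (h : X ∉ Ys) :
      Typing .box [] (Ys.map MLLFormula.neg ++ [MLLFormula.pos X])

/-- A finite partial graph with labelled nodes and edges; node names are taken in `ν` and edge names
in `ε`. The values of `label`, `prems`, `concls` outside `nodes`, and of `type` outside `edges`, are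
irrelevant. -/
structure NetGraph (α ν ε : Type*) where
  nodes : Finset ν
  edges : Finset ε
  label : ν → NodeLabel
  /-- the premises of a node, from left to right -/
  prems : ν → List ε
  /-- the conclusions of a node, from left to right -/
  concls : ν → List ε
  type : ε → MLLFormula α

namespace NetGraph

variable {α ν ε : Type*}

/-- `N` is a typed graph: the edges at each node respect the typing of its label, and an edge is the
conclusion of at most one node and the premise of at most one node. -/
structure IsTyped (N : NetGraph α ν ε) : Prop where
  prems_mem : ∀ v ∈ N.nodes, ∀ x ∈ N.prems v, x ∈ N.edges
  concls_mem : ∀ v ∈ N.nodes, ∀ x ∈ N.concls v, x ∈ N.edges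
  typing : ∀ v ∈ N.nodes,
    (N.label v).Typing ((N.prems v).map N.type) ((N.concls v).map N.type)
  prems_nodup : ∀ v ∈ N.nodes, (N.prems v).Nodup
  concls_nodup : ∀ v ∈ N.nodes, (N.concls v).Nodup
  prems_unique : ∀ v ∈ N.nodes, ∀ w ∈ N.nodes, ∀ x, x ∈ N.prems v → x ∈ N.prems w → v = w
  concls_unique : ∀ v ∈ N.nodes, ∀ w ∈ N.nodes, ∀ x, x ∈ N.concls v → x ∈ N.concls w → v = w

/-- `x` is a pending edge (premise of no node); for a proof-net these are its conclusions. -/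
def IsConclusion (N : NetGraph α ν ε) (x : ε) : Prop :=
  x ∈ N.edges ∧ ∀ v ∈ N.nodes, x ∉ N.prems v

/-- The edge `x` joins the nodes `v` and `w` (in either direction). -/
def Joins (N : NetGraph α ν ε) (x : ε) (v w : ν) : Prop :=
  v ∈ N.nodes ∧ w ∈ N.nodes ∧
    ((x ∈ N.concls v ∧ x ∈ N.prems w) ∨ (x ∈ N.concls w ∧ x ∈ N.prems v))

/-- A cycle of length `k + 1` of the underlying undirected multigraph: pairwise distinct nodes
`v 0, …, v k` and pairwise distinct edges `x 0, …, x k`, where `x i` joins `v i` and `v (i + 1)`,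
indices being read modulo `k + 1`. -/
structure IsCycle (N : NetGraph α ν ε) {k : ℕ} (v : Fin (k + 1) → ν) (x : Fin (k + 1) → ε) :
    Prop where
  nodes_injective : Function.Injective v
  edges_injective : Function.Injective x
  joins : ∀ i, N.Joins (x i) (v i) (v (i + 1))

/-- Correctness: every cycle uses two premises of a same `par`-node or of a same
contraction-node. -/
def IsCorrect (N : NetGraph α ν ε) : Prop :=
  ∀ (k : ℕ) (v : Fin (k + 1) → ν) (x : Fin (k + 1) → ε), N.IsCycle v x →
    ∃ w ∈ N.nodes, (N.label w = .par ∨ N.label w = .contr) ∧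
      ∃ i j, i ≠ j ∧ x i ∈ N.prems w ∧ x j ∈ N.prems w

/-- Proof-nets: correct typed graphs in which every edge is the conclusion of some node. -/
structure IsProofNet (N : NetGraph α ν ε) : Prop where
  typed : N.IsTyped
  edge_is_concl : ∀ x ∈ N.edges, ∃ v ∈ N.nodes, x ∈ N.concls v
  correct : N.IsCorrect

/-- The graph with node set `W` and edge set `F` and all labels and incidences inherited
from `N`. -/
def restrict (N : NetGraph α ν ε) (W : Finset ν) (F : Finset ε) : NetGraph α ν ε :=
  { N with nodes := W, edges := F }

/-- `M` reduces to `N` by one `⊗/⅋`-step. The redex is the cut `c` between the conclusion `e` of the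
`⊗`-node `t`, of premises `a, b`, and the conclusion `f` of the `⅋`-node `p`, of premises `a', b'`.
These three nodes and the two edges `e, f` are replaced by two new cuts, `c₁` between `a` and `a'`
and `c₂` between `b` and `b'`; everything else is left unchanged. -/
structure TensorParStep (M N : NetGraph α ν ε) (c t p : ν) (e f a b a' b' : ε) (c₁ c₂ : ν) :
    Prop where
  c_mem : c ∈ M.nodes
  t_mem : t ∈ M.nodes
  p_mem : p ∈ M.nodes
  c_label : M.label c = .cut
  t_label : M.label t = .tensor
  p_label : M.label p = .par
  c_prems : (M.prems c).Perm [e, f]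
  t_prems : M.prems t = [a, b]
  t_concls : M.concls t = [e]
  p_prems : M.prems p = [a', b']
  p_concls : M.concls p = [f]
  c₁_fresh : c₁ ∉ M.nodes
  c₂_fresh : c₂ ∉ M.nodes
  c₁_ne_c₂ : c₁ ≠ c₂
  mem_nodes : ∀ v, v ∈ N.nodes ↔ (v ∈ M.nodes ∧ v ≠ c ∧ v ≠ t ∧ v ≠ p) ∨ v = c₁ ∨ v = c₂
  mem_edges : ∀ x, x ∈ N.edges ↔ x ∈ M.edges ∧ x ≠ e ∧ x ≠ f
  c₁_label : N.label c₁ = .cut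
  c₂_label : N.label c₂ = .cut
  c₁_prems : (N.prems c₁).Perm [a, a']
  c₂_prems : (N.prems c₂).Perm [b, b']
  c₁_concls : N.concls c₁ = []
  c₂_concls : N.concls c₂ = []
  nodes_unchanged : ∀ v ∈ M.nodes, v ≠ c → v ≠ t → v ≠ p →
    N.label v = M.label v ∧ N.prems v = M.prems v ∧ N.concls v = M.concls v
  edges_unchanged : ∀ x ∈ N.edges, N.type x = M.type x

end NetGraph

/-- A graph together with `n` chosen subgraphs, given by their nodes and edges. -/
structure PartitionedNet (α ν ε : Type*) (n : ℕ) where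
  net : NetGraph α ν ε
  partNodes : Fin n → Finset ν
  partEdges : Fin n → Finset ε

namespace PartitionedNet

variable {α ν ε : Type*} {n : ℕ}

/-- The `i`-th chosen subgraph. -/
def part (R : PartitionedNet α ν ε n) (i : Fin n) : NetGraph α ν ε :=
  R.net.restrict (R.partNodes i) (R.partEdges i)

/-- `c` is a cut-node which lies in none of the chosen subgraphs and whose two premises are
conclusions of the `i`-th and of the `j`-th one. -/
def IsCutBetween (R : PartitionedNet α ν ε n) (c : ν) (i j : Fin n) : Prop :=
  c ∈ R.net.nodes ∧ (∀ k, c ∉ R.partNodes k) ∧ R.net.label c = .cut ∧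
    ∃ a b, (R.net.prems c).Perm [a, b] ∧ (R.part i).IsConclusion a ∧ (R.part j).IsConclusion b

theorem IsCutBetween.symm {R : PartitionedNet α ν ε n} {c : ν} {i j : Fin n}
    (h : R.IsCutBetween c i j) : R.IsCutBetween c j i := by
  obtain ⟨hc, hk, hl, a, b, hp, ha, hb⟩ := h
  exact ⟨hc, hk, hl, b, a, hp.trans (List.Perm.swap b a []), hb, ha⟩

/-- The proof-net `R.net` is partitioned into the sub-nets `R.part i` and cut-nodes which separate
them. -/
structure IsPartition (R : PartitionedNet α ν ε n) : Prop where
  isProofNet : R.net.IsProofNet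
  partNodes_subset : ∀ i, R.partNodes i ⊆ R.net.nodes
  partEdges_subset : ∀ i, R.partEdges i ⊆ R.net.edges
  part_isProofNet : ∀ i, (R.part i).IsProofNet
  partNodes_disjoint : ∀ i j, i ≠ j → Disjoint (R.partNodes i) (R.partNodes j)
  partEdges_disjoint : ∀ i j, i ≠ j → Disjoint (R.partEdges i) (R.partEdges j)
  edges_covered : ∀ x ∈ R.net.edges, ∃ i, x ∈ R.partEdges i
  nodes_covered : ∀ v ∈ R.net.nodes,
    (∃ i, v ∈ R.partNodes i) ∨ ∃ i j, i ≠ j ∧ R.IsCutBetween v i j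

/-- The skeleton: its vertices are the sub-nets, adjacent when there is at least one cut between
them. -/
def skeleton (R : PartitionedNet α ν ε n) : SimpleGraph (Fin n) where
  Adj i j := i ≠ j ∧ ∃ c, R.IsCutBetween c i j
  symm := ⟨fun _ _ ⟨hij, c, hc⟩ => ⟨hij.symm, c, hc.symm⟩⟩
  loopless := ⟨fun _ h => h.1 rfl⟩

/-- Cut-nets. -/
structure IsCutNet (R : PartitionedNet α ν ε n) : Prop where
  isPartition : R.IsPartition
  skeleton_isTree : R.skeleton.IsTree

/-- `R'` is obtained from `R` by one `⊗/⅋`-expansion on two cuts between the `i`-th and the `j`-th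
sub-net, which puts the new `⊗`-node in the `i`-th and the new `⅋`-node in the `j`-th sub-net; the
other sub-nets keep their nodes and edges. Both `R` and `R'` have to be proof-nets. -/
def ExpandsAt (R R' : PartitionedNet α ν ε n) (i j : Fin n) : Prop :=
  R.net.IsProofNet ∧ R'.net.IsProofNet ∧ i ≠ j ∧
  ∃ (c t p : ν) (e f a b a' b' : ε) (c₁ c₂ : ν),
    R'.net.TensorParStep R.net c t p e f a b a' b' c₁ c₂ ∧
    R.IsCutBetween c₁ i j ∧ R.IsCutBetween c₂ i j ∧
    a ∈ R.partEdges i ∧ b ∈ R.partEdges i ∧ a' ∈ R.partEdges j ∧ b' ∈ R.partEdges j ∧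
    (∀ k v, v ∈ R'.partNodes k ↔ v ∈ R.partNodes k ∨ (k = i ∧ v = t) ∨ (k = j ∧ v = p)) ∧
    (∀ k x, x ∈ R'.partEdges k ↔ x ∈ R.partEdges k ∨ (k = i ∧ x = e) ∨ (k = j ∧ x = f))

/-- One `⊗/⅋`-expansion on cuts between some pair of sub-nets. -/
def Expands (R R' : PartitionedNet α ν ε n) : Prop :=
  ∃ i j, R.ExpandsAt R' i j

end PartitionedNet

/-! Correctness is read as a statement about edge-coloured multigraphs. At each node every edge has
its own colour, except that all premises of a `par`-node or of a contraction-node share one; a cusp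
is a pair of consecutive edges of equal colour at their common vertex. A typed graph without loops
is then correct exactly when every simple closed walk has a cusp (`NetGraph.IsCorrect.cuspAcyclic`,
`NetGraph.isCorrect_of_cuspAcyclic`).

An expansion always yields a typed graph; only its correctness depends on the choice of the cuts.
Let the cut `c₁` have premises `a, a'` and `c₂` premises `b, b'`, and let the `⊗`-node take `a, b`.
Any new cusp-free cycle must pass through the `⊗`-node, and it yields either a cusp-free cycle of
the old net or a cusp-free path between `c₁` and `c₂` which uses `a` at `c₁` or `b` at `c₂`. So the
expansion is correct if there is no such path (`EdgeDart.IsExpansion.cuspAcyclic`). Paths which use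
`a'` and `b'` are harmless: they close with a cusp at the `⅋`-node.

Now let two sub-nets have several cuts between them. The skeleton is a tree, so its edge between
them is a bridge, and these cuts divide the edges of the net into two sides. It suffices to find two
of the cuts such that all cusp-free paths between them begin and end on one and the same side: the
`⅋`-node goes on that side and the `⊗`-node on the other. Such a pair is given by
`EdgeDart.exists_pair`, whose induction rests on Yeo's theorem (`EdgeDart.exists_isSplitting`). A
splitting vertex `v` sees each component of its complement through a single colour. If a component
contains two of the cuts, no cusp-free path between them can leave it through `v`, and the induction
continues there. Otherwise each component contains at most one cut, and the paths to consider change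
side nowhere between their ends.

Each expansion replaces two cuts by one and keeps the skeleton, so the process ends, and it can only
end when no pair of sub-nets has two cuts. -/

/-! ### Walks and cusps in edge-coloured multigraphs -/

/-- An edge together with a direction in which it is crossed. -/
structure EdgeDart (V E : Type*) where
  src : V
  edge : E
  tgt : V

namespace EdgeDart

variable {V E C : Type*}

/-- The same edge, crossed in the other direction. -/
def rev (d : EdgeDart V E) : EdgeDart V E := ⟨d.tgt, d.edge, d.src⟩

/-- `IsWalk J u l w`: the list `l` is a walk from `u` to `w` in the multigraph where `J x u w` says
that the edge `x` joins `u` and `w`. -/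
def IsWalk (J : E → V → V → Prop) : V → List (EdgeDart V E) → V → Prop
  | u, [], w => u = w
  | u, d :: l, w => d.src = u ∧ J d.edge d.src d.tgt ∧ IsWalk J d.tgt l w

/-- The vertices of a walk, the last one excepted. -/
def srcs (l : List (EdgeDart V E)) : List V := l.map src

/-- The reverse of a walk. -/
def revWalk (l : List (EdgeDart V E)) : List (EdgeDart V E) := (l.map rev).reverse

/-- `CuspFree col l`: consecutive edges of `l` have distinct colours at the vertex they share, where
`col v x` is the colour of the edge `x` at the vertex `v`. -/
def CuspFree (col : V → E → C) (l : List (EdgeDart V E)) : Prop :=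
  l.IsChain fun d₁ d₂ => col d₁.tgt d₁.edge ≠ col d₂.src d₂.edge

/-- The last edge of `l` and the first edge of `l'` do not form a cusp. -/
def NoCusp (col : V → E → C) (l l' : List (EdgeDart V E)) : Prop :=
  ∀ d₁ ∈ l.getLast?, ∀ d₂ ∈ l'.head?, col d₁.tgt d₁.edge ≠ col d₂.src d₂.edge

/-- Every simple closed walk has a cusp. -/
def CuspAcyclic (J : E → V → V → Prop) (col : V → E → C) : Prop :=
  ∀ v l, IsWalk J v l v → (srcs l).Nodup → l ≠ [] → CuspFree col l → ¬ NoCusp col l l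

/-- Every simple closed walk at `v` has a cusp at `v`. -/
def IsSplitting (J : E → V → V → Prop) (col : V → E → C) (v : V) : Prop :=
  ∀ l, IsWalk J v l v → (srcs l).Nodup → l ≠ [] → ¬ NoCusp col l l

@[simp] theorem rev_src (d : EdgeDart V E) : d.rev.src = d.tgt := rfl
@[simp] theorem rev_tgt (d : EdgeDart V E) : d.rev.tgt = d.src := rfl
@[simp] theorem rev_edge (d : EdgeDart V E) : d.rev.edge = d.edge := rfl

@[simp] theorem srcs_nil : srcs ([] : List (EdgeDart V E)) = [] := rfl
@[simp] theorem srcs_cons (d : EdgeDart V E) (l) : srcs (d :: l) = d.src :: srcs l := rfl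
@[simp] theorem srcs_append (l l' : List (EdgeDart V E)) : srcs (l ++ l') = srcs l ++ srcs l' := by
  simp [srcs]

@[simp] theorem revWalk_revWalk (l : List (EdgeDart V E)) : revWalk (revWalk l) = l := by
  induction l with
  | nil => rfl
  | cons d l ih => simp [revWalk, Function.comp_def, rev]

@[simp] theorem revWalk_eq_nil {l : List (EdgeDart V E)} : revWalk l = [] ↔ l = [] := by
  simp [revWalk]

variable {J : E → V → V → Prop} {col : V → E → C}

theorem IsWalk.append {u v w : V} {l l' : List (EdgeDart V E)} (h : IsWalk J u l v)
    (h' : IsWalk J v l' w) : IsWalk J u (l ++ l') w := by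
  induction l generalizing u with
  | nil => cases h; exact h'
  | cons d l ih => exact ⟨h.1, h.2.1, ih h.2.2⟩

theorem isWalk_append {u w : V} {l l' : List (EdgeDart V E)} :
    IsWalk J u (l ++ l') w ↔ ∃ v, IsWalk J u l v ∧ IsWalk J v l' w := by
  refine ⟨fun h => ?_, fun ⟨v, h, h'⟩ => h.append h'⟩
  induction l generalizing u with
  | nil => exact ⟨u, rfl, h⟩
  | cons d l ih =>
    obtain ⟨v, h1, h2⟩ := ih h.2.2
    exact ⟨v, ⟨h.1, h.2.1, h1⟩, h2⟩

theorem IsWalk.single {d : EdgeDart V E} (h : J d.edge d.src d.tgt) :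
    IsWalk J d.src [d] d.tgt := ⟨rfl, h, rfl⟩

theorem IsWalk.revWalk (hJ : ∀ x u w, J x u w → J x w u) {u w : V} {l : List (EdgeDart V E)}
    (h : IsWalk J u l w) : IsWalk J w (revWalk l) u := by
  induction l generalizing u with
  | nil => cases h; rfl
  | cons d l ih =>
    obtain ⟨rfl, h1, h2⟩ := h
    have : EdgeDart.revWalk (d :: l) = EdgeDart.revWalk l ++ [d.rev] := by simp [EdgeDart.revWalk]
    rw [this]
    exact (ih h2).append ⟨rfl, hJ _ _ _ h1, rfl⟩

theorem IsWalk.mono {J' : E → V → V → Prop} {u w : V} {l : List (EdgeDart V E)}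
    (h : IsWalk J u l w) (hJ : ∀ d ∈ l, J d.edge d.src d.tgt → J' d.edge d.src d.tgt) :
    IsWalk J' u l w := by
  induction l generalizing u with
  | nil => exact h
  | cons d l ih =>
    exact ⟨h.1, hJ d (by simp) h.2.1, ih h.2.2 fun d' hd' => hJ d' (by simp [hd'])⟩

theorem IsWalk.joins {u w : V} {l : List (EdgeDart V E)} (h : IsWalk J u l w) :
    ∀ d ∈ l, J d.edge d.src d.tgt := by
  induction l generalizing u with
  | nil => simp
  | cons d l ih =>
    intro d' hd'
    rcases List.mem_cons.1 hd' with rfl | hd'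
    · exact h.2.1
    · exact ih h.2.2 d' hd'

theorem IsWalk.head_src {u w : V} {l : List (EdgeDart V E)} (h : IsWalk J u l w) :
    ∀ d ∈ l.head?, d.src = u := by
  cases l with
  | nil => simp
  | cons d l => simpa using h.1

theorem IsWalk.getLast_tgt {u w : V} {l : List (EdgeDart V E)} (h : IsWalk J u l w) :
    ∀ d ∈ l.getLast?, d.tgt = w := by
  induction l using List.reverseRecOn with
  | nil => simp
  | append_singleton l d _ =>
    obtain ⟨v, -, h1⟩ := isWalk_append.1 h
    simpa using (show d.tgt = w from h1.2.2)

theorem IsWalk.start_mem_srcs {u w : V} {l : List (EdgeDart V E)} (h : IsWalk J u l w) (hl : l ≠ []) :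
    u ∈ srcs l := by
  cases l with
  | nil => exact absurd rfl hl
  | cons d l => simp [h.1]

theorem mem_srcs_revWalk {x : V} {l : List (EdgeDart V E)} :
    x ∈ srcs (revWalk l) ↔ ∃ d ∈ l, d.tgt = x := by
  simp [srcs, revWalk]

theorem mem_srcs {x : V} {l : List (EdgeDart V E)} : x ∈ srcs l ↔ ∃ d ∈ l, d.src = x := by
  simp [srcs]

/-- Both sides list all the vertices of the walk with both ends. Simplicity is carried over to
reversed walks in this way. -/
theorem IsWalk.perm {u w : V} {l : List (EdgeDart V E)} (h : IsWalk J u l w) :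
    (w :: srcs l).Perm (u :: srcs (EdgeDart.revWalk l)) := by
  induction l generalizing u with
  | nil => cases h; rfl
  | cons d l ih =>
    obtain ⟨rfl, -, h⟩ := h
    have : srcs (EdgeDart.revWalk (d :: l)) = srcs (EdgeDart.revWalk l) ++ [d.tgt] := by
      simp [EdgeDart.revWalk]
    rw [this, srcs_cons]
    refine (List.Perm.swap _ _ _).trans (List.Perm.cons _ ((ih h).trans ?_))
    exact (List.perm_append_singleton _ _).symm

/-- A visited vertex splits a walk. -/
theorem IsWalk.exists_split {u w x : V} {l : List (EdgeDart V E)} (h : IsWalk J u l w)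
    (hx : x ∈ srcs l) :
    ∃ l₁ l₂, l = l₁ ++ l₂ ∧ l₂ ≠ [] ∧ IsWalk J u l₁ x ∧ IsWalk J x l₂ w := by
  obtain ⟨d, hd, rfl⟩ := mem_srcs.1 hx
  obtain ⟨l₁, l₂, rfl⟩ := List.append_of_mem hd
  obtain ⟨v, h1, h2⟩ := isWalk_append.1 h
  have := h2.1
  subst this
  exact ⟨l₁, d :: l₂, rfl, by simp, h1, h2⟩

theorem cuspFree_append {l l' : List (EdgeDart V E)} :
    CuspFree col (l ++ l') ↔ CuspFree col l ∧ CuspFree col l' ∧ NoCusp col l l' :=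
  List.isChain_append

theorem CuspFree.revWalk {l : List (EdgeDart V E)} (h : CuspFree col l) :
    CuspFree col (revWalk l) := by
  unfold CuspFree EdgeDart.revWalk at *
  rw [List.isChain_reverse, List.isChain_map]
  exact h.imp fun _ _ h => h.symm

@[simp] theorem getLast?_revWalk {l : List (EdgeDart V E)} :
    (revWalk l).getLast? = l.head?.map rev := by
  simp [revWalk]

@[simp] theorem head?_revWalk {l : List (EdgeDart V E)} :
    (revWalk l).head? = l.getLast?.map rev := by
  simp [revWalk]

theorem NoCusp.revWalk {l l' : List (EdgeDart V E)} (h : NoCusp col l l') :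
    NoCusp col (EdgeDart.revWalk l') (EdgeDart.revWalk l) := by
  intro d hd d' hd'
  simp only [getLast?_revWalk, head?_revWalk, Option.mem_def, Option.map_eq_some_iff] at hd hd'
  obtain ⟨y, hy, rfl⟩ := hd
  obtain ⟨x, hx, rfl⟩ := hd'
  exact (h x hx y hy).symm

theorem noCusp_append_left {l₁ l₂ l : List (EdgeDart V E)} (h : l₂ ≠ []) :
    NoCusp col (l₁ ++ l₂) l ↔ NoCusp col l₂ l := by
  unfold NoCusp
  rw [List.getLast?_append_of_ne_nil _ h]

theorem noCusp_append_right {l₁ l₂ l : List (EdgeDart V E)} (h : l₁ ≠ []) :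
    NoCusp col l (l₁ ++ l₂) ↔ NoCusp col l l₁ := by
  unfold NoCusp
  rw [List.head?_append_of_ne_nil _ h]

/-- A simple cusp-free closed walk can be started at any of its vertices. -/
theorem exists_rotate {v x : V} {l : List (EdgeDart V E)} (h : IsWalk J v l v)
    (hn : (srcs l).Nodup) (hc : CuspFree col l) (hv : NoCusp col l l) (hx : x ∈ srcs l) :
    ∃ l', IsWalk J x l' x ∧ (srcs l').Nodup ∧ l' ≠ [] ∧ CuspFree col l' ∧ NoCusp col l' l' ∧
      l'.Perm l := by
  obtain ⟨l₁, l₂, rfl, h2, hw1, hw2⟩ := h.exists_split hx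
  obtain ⟨hc1, hc2, hc3⟩ := cuspFree_append.1 hc
  refine ⟨l₂ ++ l₁, hw2.append hw1, ?_, by simp [h2], cuspFree_append.2 ⟨hc2, hc1, ?_⟩, ?_,
    List.perm_append_comm⟩
  · rw [srcs_append] at hn ⊢
    exact List.nodup_append_comm.1 hn
  · rcases l₁ with _ | ⟨d, l₁⟩
    · simp [NoCusp]
    · rwa [noCusp_append_left h2, noCusp_append_right (by simp)] at hv
  · rcases l₁ with _ | ⟨d, l₁⟩
    · simpa using hv
    · rwa [noCusp_append_left (by simp), noCusp_append_right h2]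

/-- A walk contains a simple one. -/
theorem IsWalk.exists_simple {u w : V} {l : List (EdgeDart V E)} (h : IsWalk J u l w) :
    ∃ l', IsWalk J u l' w ∧ (srcs l').Nodup ∧ w ∉ srcs l' := by
  induction l generalizing u with
  | nil => exact ⟨[], h, by simp, by simp⟩
  | cons d l ih =>
    obtain ⟨rfl, hd, h⟩ := h
    obtain ⟨l', hl', hn, hw⟩ := ih h
    by_cases hdw : w = d.src
    · exact ⟨[], hdw.symm, by simp, by simp⟩
    by_cases hs : d.src ∈ srcs l'
    · obtain ⟨l₁, l₂, rfl, h2, hw1, hw2⟩ := hl'.exists_split hs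
      rw [srcs_append] at hn hw
      exact ⟨l₂, hw2, hn.of_append_right, fun h => hw (by simp [h])⟩
    · exact ⟨d :: l', ⟨rfl, hd, hl'⟩, by simp [hs, hn], by simp [hdw, hw]⟩

end EdgeDart

/-! ### Yeo's theorem -/

namespace EdgeDart

variable {V E C : Type*} {J : E → V → V → Prop} {col : V → E → C}

open Classical in
/-- The number of cusps of a walk, regardless of its ends. -/
noncomputable def numCusps (col : V → E → C) : List (EdgeDart V E) → ℕ
  | [] => 0
  | d :: l => (if NoCusp col [d] l then 0 else 1) + numCusps col l

open Classical in
theorem numCusps_append (l l' : List (EdgeDart V E)) :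
    numCusps col (l ++ l') =
      numCusps col l + numCusps col l' + (if NoCusp col l l' then 0 else 1) := by
  induction l with
  | nil => simp [numCusps, NoCusp]
  | cons d l ih =>
    rcases l with _ | ⟨d', l⟩
    · simp [numCusps, NoCusp]; omega
    · have h1 : NoCusp col [d] ((d' :: l) ++ l') ↔ NoCusp col [d] (d' :: l) :=
        noCusp_append_right (by simp)
      have h2 : NoCusp col ([d] ++ (d' :: l)) l' ↔ NoCusp col (d' :: l) l' :=
        noCusp_append_left (by simp)
      have h3 : NoCusp col (d :: d' :: l) l' ↔ NoCusp col (d' :: l) l' := h2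
      have h4 : numCusps col (d :: d' :: l) =
        (if NoCusp col [d] (d' :: l) then 0 else 1) + numCusps col (d' :: l) := rfl
      rw [List.cons_append, numCusps, ih, h4]
      simp only [h1, h3]
      omega

theorem cuspFree_iff_numCusps {l : List (EdgeDart V E)} :
    CuspFree col l ↔ numCusps col l = 0 := by
  classical
  induction l with
  | nil => simp [CuspFree, numCusps]
  | cons d l ih =>
    have : CuspFree col ([d] ++ l) ↔ _ := cuspFree_append
    rw [numCusps, ← List.singleton_append, this, ih]
    by_cases h : NoCusp col [d] l <;> simp [h, CuspFree]

/-- Cut a walk at its first cusp. -/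
theorem exists_first_cusp {l : List (EdgeDart V E)} (h : ¬ CuspFree col l) :
    ∃ p p', l = p ++ p' ∧ CuspFree col p ∧ ¬ NoCusp col p p' := by
  induction l using List.reverseRecOn with
  | nil => simp [CuspFree] at h
  | append_singleton l d ih =>
    by_cases hl : CuspFree col l
    · refine ⟨l, [d], rfl, hl, fun hd => h (cuspFree_append.2 ⟨hl, by simp [CuspFree], hd⟩)⟩
    · obtain ⟨p, p', rfl, hp, hpp⟩ := ih hl
      refine ⟨p, p' ++ [d], by simp, hp, ?_⟩
      rcases p' with _ | ⟨d', p'⟩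
      · simp [NoCusp] at hpp
      · rwa [noCusp_append_right (by simp)]

theorem not_noCusp {l l' : List (EdgeDart V E)} (h : ¬ NoCusp col l l') :
    ∃ m d d' m', l = m ++ [d] ∧ l' = d' :: m' ∧ col d.tgt d.edge = col d'.src d'.edge := by
  unfold NoCusp at h
  push Not at h
  obtain ⟨d, hd, d', hd', h⟩ := h
  obtain ⟨m, rfl⟩ := List.getLast?_eq_some_iff.1 hd
  obtain ⟨m', rfl⟩ := List.head?_eq_some_iff.1 hd'
  exact ⟨m, d, d', m', rfl, rfl, h⟩

/-- In a cusp the two edges have one common colour, so a continuation `k` which avoids the colour of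
the one avoids that of the other: at this vertex it is possible to come back along `k` and leave
along `l'`. -/
theorem noCusp_revWalk_left_of_cusp {l l' k : List (EdgeDart V E)} (h : ¬ NoCusp col l l')
    (hk : NoCusp col l k) : NoCusp col (revWalk k) l' := by
  obtain ⟨m, d, d', m', rfl, rfl, hdd⟩ := not_noCusp h
  intro x hx y hy
  simp only [getLast?_revWalk, Option.mem_def, Option.map_eq_some_iff, List.head?_cons,
    Option.some.injEq] at hx hy
  obtain ⟨z, hz, rfl⟩ := hx
  subst hy
  have := hk d (by simp) z hz
  rw [hdd] at this
  exact this.symm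

theorem noCusp_revWalk_right_of_cusp {l l' k : List (EdgeDart V E)} (h : ¬ NoCusp col l l')
    (hk : NoCusp col k l') : NoCusp col k (revWalk l) := by
  obtain ⟨m, d, d', m', rfl, rfl, hdd⟩ := not_noCusp h
  intro x hx y hy
  simp only [head?_revWalk, Option.mem_def, Option.map_eq_some_iff] at hx hy
  obtain ⟨z, hz, rfl⟩ := hy
  have := hk x hx d' (by simp)
  simp at hz
  subst hz
  rw [← hdd] at this
  exact this

/-- Let `p ++ p'` be a simple closed walk at `v` without cusp at `v` and with as few cusps as
possible, where `p` ends at its first cusp. A cusp-free walk which prolongs `p` never comes back to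
this closed walk. -/
theorem not_mem_of_min_numCusps (hJ : ∀ x u w, J x u w → J x w u) (hac : CuspAcyclic J col)
    {v u : V} {p p' : List (EdgeDart V E)} (hp : IsWalk J v p u) (hp' : IsWalk J u p' v)
    (hn : (srcs (p ++ p')).Nodup) (hv : NoCusp col (p ++ p') (p ++ p'))
    (hmin : ∀ l, IsWalk J v l v → (srcs l).Nodup → l ≠ [] → NoCusp col l l →
      numCusps col (p ++ p') ≤ numCusps col l)
    (hcf : CuspFree col p) (hcusp : ¬ NoCusp col p p')
    {q : List (EdgeDart V E)} {y : V} (hq : IsWalk J u q y) (hqn : (srcs q).Nodup)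
    (hqc : CuspFree col q) (hpq : NoCusp col p q) (hyu : y ≠ u) : y ∉ srcs (p ++ p') := by
  classical
  induction hk : q.length using Nat.strong_induction_on generalizing q y with
  | _ k ih =>
  intro hy
  subst hk
  -- An inner vertex of `q` ends a shorter prolongation, so the induction hypothesis applies: `y`
  -- would be the first return to the closed walk.
  have hinner : ∀ x ∈ srcs q, x ≠ u → x ∉ srcs (p ++ p') := by
    intro x hx hxu
    obtain ⟨q₁, q₂, rfl, h2, hw1, hw2⟩ := hq.exists_split hx
    rw [srcs_append] at hqn
    have hq1 : q₁ ≠ [] := by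
      rintro rfl
      exact hxu hw1.symm
    refine ih q₁.length ?_ hw1 hqn.of_append_left (cuspFree_append.1 hqc).1 ?_ hxu rfl
    · have := List.length_pos_iff.2 h2
      simp; omega
    · rwa [noCusp_append_right hq1] at hpq
  have hyq : y ∉ srcs q := fun h => hinner y h hyu hy
  have hq0 : q ≠ [] := by
    rintro rfl
    exact hyu hq.symm
  have hp0 : p ≠ [] := by
    rintro rfl
    simp [NoCusp] at hcusp
  have hp'0 : p' ≠ [] := by
    rintro rfl
    simp [NoCusp] at hcusp
  have hup' : u ∈ srcs p' := hp'.start_mem_srcs hp'0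
  have hperm := hq.perm
  have hrn : (u :: srcs (revWalk q)).Nodup := hperm.nodup_iff.1 (List.nodup_cons.2 ⟨hyq, hqn⟩)
  have hrev : ∀ x ∈ srcs (revWalk q), x ≠ u ∧ (x = y ∨ x ∉ srcs (p ++ p')) := by
    intro x hx
    have hxu : x ≠ u := by
      rintro rfl
      exact (List.nodup_cons.1 hrn).1 hx
    refine ⟨hxu, ?_⟩
    have := hperm.mem_iff.2 (List.mem_cons_of_mem u hx)
    rcases List.mem_cons.1 this with h | h
    · exact .inl h
    · exact .inr (hinner x h hxu)
  rw [srcs_append, List.mem_append] at hy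
  rw [srcs_append, List.nodup_append'] at hn
  obtain ⟨hnp, hnp', hdis⟩ := hn
  have hcount := numCusps_append (col := col) p p'
  rw [if_neg hcusp, cuspFree_iff_numCusps.1 hcf] at hcount
  rcases hy with hy | hy
  · obtain ⟨p₁, p₂, rfl, h2, hw1, hw2⟩ := hp.exists_split hy
    obtain ⟨hc1, hc2, hc12⟩ := cuspFree_append.1 hcf
    have hyp2 := hw2.start_mem_srcs h2
    rw [srcs_append, List.nodup_append'] at hnp
    obtain ⟨hn1, hn2, hd12⟩ := hnp
    simp only [srcs_append, List.mem_append, not_or] at hinner hrev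
    have hp2q : NoCusp col p₂ q := by rwa [noCusp_append_left h2] at hpq
    -- If the return is on `p`, then `p₂ ++ q` is a simple closed walk whose only possible cusp is
    -- at `y`, so acyclicity puts one there.
    have hqp2 : ¬ NoCusp col q p₂ := by
      have := hac y (p₂ ++ q) (hw2.append hq) ?_ (by simp [h2]) (cuspFree_append.2 ⟨hc2, hqc, hp2q⟩)
      · rwa [noCusp_append_left hq0, noCusp_append_right h2] at this
      · rw [srcs_append, List.nodup_append']
        refine ⟨hn2, hqn, fun x hx hx' => ?_⟩
        by_cases hxu : x = u
        · subst hxu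
          exact hdis (by simp [hx]) hup'
        · exact (hinner x hx' hxu).1.2 hx
    have hr0 : revWalk q ≠ [] := by simpa using hq0
    have hrp' : NoCusp col (revWalk q) p' := noCusp_revWalk_left_of_cusp hcusp hpq
    -- Going through `q` backwards instead of `p₂` creates no cusp at `y` or at `u` and removes the
    -- one between `p` and `p'`, against minimality.
    have hnew := hmin (p₁ ++ (revWalk q ++ p')) (hw1.append ((hq.revWalk hJ).append hp')) ?_
      (by simp [hp'0]) ?_
    · have hc : numCusps col (p₁ ++ (revWalk q ++ p')) = numCusps col p' := by
        rw [numCusps_append, numCusps_append, cuspFree_iff_numCusps.1 hc1,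
          cuspFree_iff_numCusps.1 hqc.revWalk, if_pos hrp', if_pos]
        · omega
        · rw [noCusp_append_right hr0]
          exact noCusp_revWalk_right_of_cusp hqp2 hc12
      omega
    · simp only [srcs_append, List.nodup_append', List.disjoint_append_right]
      refine ⟨hn1, ⟨(List.nodup_cons.1 hrn).2, hnp', ?_⟩, ?_, ?_⟩
      · intro x hx hx'
        rcases (hrev x hx).2 with rfl | h
        · exact hdis (by simp [hyp2]) hx'
        · exact h.2 hx'
      · intro x hx hx'
        rcases (hrev x hx').2 with rfl | h
        · exact hd12 hx hyp2
        · exact h.1.1 hx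
      · exact fun x hx hx' => hdis (by simp [hx]) hx'
    · have hv' : NoCusp col p' (p₁ ++ p₂) := by
        rwa [noCusp_append_left hp'0, noCusp_append_right hp0] at hv
      rw [← List.append_assoc, noCusp_append_left hp'0, noCusp_append_right (by simp [hq0])]
      rcases p₁ with _ | ⟨d, p₁⟩
      · exact noCusp_revWalk_right_of_cusp hqp2 hv'
      · rw [noCusp_append_right (by simp)] at hv' ⊢
        exact hv'
  · obtain ⟨p₁, p₂, rfl, h2, hw1, hw2⟩ := hp'.exists_split hy
    have h1 : p₁ ≠ [] := by
      rintro rfl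
      exact hyu hw1.symm
    have hyp2 := hw2.start_mem_srcs h2
    rw [srcs_append, List.nodup_append'] at hnp'
    obtain ⟨hn1, hn2, hd12⟩ := hnp'
    have hup1 := hw1.start_mem_srcs h1
    simp only [srcs_append, List.mem_append, not_or] at hinner hrev
    -- If the return is on `p'`, replacing `p₁` by `q` removes the cusp at `u` and adds at most one
    -- at `y`. By minimality `p₁` has no cusp, forms none with `p₂`, and `q` does form one with
    -- `p₂`; hence `q` followed by the reverse of `p₁` is a cusp-free cycle.
    have hnew := hmin (p ++ (q ++ p₂)) (hp.append (hq.append hw2)) ?_ (by simp [hp0]) ?_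
    · rw [hcount, numCusps_append p, numCusps_append q, if_pos ((noCusp_append_right hq0).2 hpq),
        cuspFree_iff_numCusps.1 hcf, cuspFree_iff_numCusps.1 hqc] at hnew
      rw [numCusps_append p₁] at hnew
      have hj : NoCusp col p₁ p₂ ∧ ¬ NoCusp col q p₂ ∧ numCusps col p₁ = 0 := by
        by_cases ha : NoCusp col p₁ p₂ <;> by_cases hb : NoCusp col q p₂ <;>
          simp only [ha, hb, if_true, if_false] at hnew ⊢ <;> simp <;> omega
      obtain ⟨ha, hb, hc⟩ := hj
      have hr0 : revWalk p₁ ≠ [] := by simpa using h1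
      have hqp : NoCusp col (revWalk q) p₁ := by
        refine noCusp_revWalk_left_of_cusp (fun h => hcusp ?_) hpq
        rwa [noCusp_append_right h1]
      refine hac u (q ++ revWalk p₁) (hq.append (hw1.revWalk hJ)) ?_ (by simp [hq0])
        (cuspFree_append.2 ⟨hqc, (cuspFree_iff_numCusps.2 hc).revWalk, ?_⟩) ?_
      · rw [srcs_append, List.nodup_append']
        have hr1 : (u :: srcs (revWalk p₁)).Nodup :=
          hw1.perm.nodup_iff.1 (List.nodup_cons.2 ⟨fun h => hd12 h hyp2, hn1⟩)
        refine ⟨hqn, (List.nodup_cons.1 hr1).2, fun x hx hx' => ?_⟩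
        have hxu : x ≠ u := by
          rintro rfl
          exact (List.nodup_cons.1 hr1).1 hx'
        rcases List.mem_cons.1 (hw1.perm.mem_iff.2 (List.mem_cons_of_mem u hx')) with rfl | h
        · exact hyq hx
        · exact (hinner x hx hxu).2.1 h
      · have := noCusp_revWalk_right_of_cusp hb ha
        simpa using this.revWalk
      · rw [noCusp_append_left hr0, noCusp_append_right hq0]
        simpa using hqp.revWalk
    · simp only [srcs_append, List.nodup_append', List.disjoint_append_right]
      refine ⟨hnp, ⟨hqn, hn2, ?_⟩, ?_, ?_⟩
      · intro x hx hx'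
        by_cases hxu : x = u
        · subst hxu
          exact hd12 hup1 hx'
        · exact (hinner x hx hxu).2.2 hx'
      · intro x hx hx'
        by_cases hxu : x = u
        · subst hxu
          exact hdis hx (by simp [hup1])
        · exact (hinner x hx' hxu).1 hx
      · exact fun x hx hx' => hdis hx (by simp [hx'])
    · rw [← List.append_assoc, noCusp_append_left h2, List.append_assoc, noCusp_append_right hp0]
      rwa [← List.append_assoc, noCusp_append_left h2, List.append_assoc,
        noCusp_append_right hp0] at hv

/-- A vertex at which some simple closed walk has no cusp starts a cusp-free path, not beginning
with a given colour, to which no cusp-free prolongation comes back. -/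
theorem exists_path_of_not_isSplitting (hJ : ∀ x u w, J x u w → J x w u)
    (hac : CuspAcyclic J col) {u : V} (hu : ¬ IsSplitting J col u) (p : List (EdgeDart V E)) :
    ∃ r w, IsWalk J u r w ∧ r ≠ [] ∧ (srcs r).Nodup ∧ w ∉ srcs r ∧ CuspFree col r ∧
      NoCusp col p r ∧
      ∀ q y, IsWalk J w q y → (srcs q).Nodup → CuspFree col q → NoCusp col r q → y ∉ srcs r := by
  classical
  unfold IsSplitting at hu
  push Not at hu
  have hex : ∃ m l, IsWalk J u l u ∧ (srcs l).Nodup ∧ l ≠ [] ∧ NoCusp col l l ∧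
      numCusps col l = m := by
    obtain ⟨l, h1, h2, h3, h4⟩ := hu
    exact ⟨_, l, h1, h2, h3, h4, rfl⟩
  obtain ⟨l₀, h1, h2, h3, h4, h5⟩ := Nat.find_spec hex
  have hmin₀ : ∀ l, IsWalk J u l u → (srcs l).Nodup → l ≠ [] → NoCusp col l l →
      numCusps col l₀ ≤ numCusps col l := fun l k1 k2 k3 k4 => by
    rw [h5]
    exact Nat.find_min' hex ⟨l, k1, k2, k3, k4, rfl⟩
  have hcl : numCusps col (revWalk l₀) = numCusps col l₀ := by
    have key : ∀ l : List (EdgeDart V E), numCusps col (revWalk l) = numCusps col l := by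
      intro l
      induction l with
      | nil => rfl
      | cons d l ih =>
        have e : revWalk (d :: l) = revWalk l ++ revWalk [d] := by simp [revWalk]
        have hiff : NoCusp col (revWalk l) (revWalk [d]) ↔ NoCusp col [d] l :=
          ⟨fun h => by simpa using h.revWalk, fun h => h.revWalk⟩
        have h0 : numCusps col (revWalk [d]) = 0 := by simp [revWalk, numCusps, NoCusp]
        rw [e, numCusps_append, ih, numCusps, h0]
        simp only [hiff]
        omega
    exact key l₀
  -- The two ends of `l₀` have different colours at `u`, so the last edge of `p` can match at most
  -- one of them: one of the two directions of `l₀` is available.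
  have hor : NoCusp col p l₀ ∨ NoCusp col p (revWalk l₀) := by
    by_contra! hcon
    obtain ⟨hc1, hc2⟩ := hcon
    obtain ⟨m, d, d₁, m₁, rfl, e1, hd1⟩ := not_noCusp hc1
    obtain ⟨m', d', d₂, m₂, e, e2, hd2⟩ := not_noCusp hc2
    obtain ⟨-, h⟩ := List.append_inj' e rfl
    simp only [List.cons.injEq, and_true] at h
    subst h
    have hh : l₀.getLast?.map rev = some d₂ := by rw [← head?_revWalk, e2]; rfl
    obtain ⟨z, hz, rfl⟩ := Option.map_eq_some_iff.1 hh
    exact h4 z hz d₁ (by simp [e1]) (hd2.symm.trans hd1)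
  obtain ⟨l, k1, k2, k3, k4, hmin, hpl⟩ : ∃ l, IsWalk J u l u ∧ (srcs l).Nodup ∧ l ≠ [] ∧
      NoCusp col l l ∧ (∀ l', IsWalk J u l' u → (srcs l').Nodup → l' ≠ [] → NoCusp col l' l' →
      numCusps col l ≤ numCusps col l') ∧ NoCusp col p l := by
    rcases hor with h | h
    · exact ⟨l₀, h1, h2, h3, h4, hmin₀, h⟩
    · refine ⟨revWalk l₀, h1.revWalk hJ, ?_, by simpa using h3, h4.revWalk, ?_, h⟩
      · exact (List.perm_cons u |>.1 h1.perm).nodup_iff.1 h2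
      · rwa [hcl]
  -- There is no cusp at `u`, so acyclicity gives one elsewhere on `l`; the path sought is the part
  -- of `l` before the first of them.
  obtain ⟨r, r', rfl, hr, hrr⟩ := exists_first_cusp fun h => hac u l k1 k2 k3 h k4
  obtain ⟨w, hw1, hw2⟩ := isWalk_append.1 k1
  have hr0 : r ≠ [] := by
    rintro rfl
    simp [NoCusp] at hrr
  have hr'0 : r' ≠ [] := by
    rintro rfl
    simp [NoCusp] at hrr
  have k2' := k2
  rw [srcs_append, List.nodup_append'] at k2'
  have hwr : w ∉ srcs r := fun h => k2'.2.2 h (hw2.start_mem_srcs hr'0)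
  refine ⟨r, w, hw1, hr0, k2'.1, hwr, hr, by rwa [noCusp_append_right hr0] at hpl, ?_⟩
  intro q y hq hqn hqc hrq hy
  refine not_mem_of_min_numCusps hJ hac hw1 hw2 k2 k4 hmin hr hrr hq hqn hqc hrq ?_ ?_
  · rintro rfl
    exact hwr hy
  · simp [hy]

/-- **Yeo's theorem** for local colourings: a nonempty finite multigraph in which every simple
closed walk has a cusp contains a splitting vertex. -/
theorem exists_isSplitting (hJ : ∀ x u w, J x u w → J x w u) (hac : CuspAcyclic J col)
    (W : Finset V) (hW : W.Nonempty) (hJW : ∀ x u w, J x u w → u ∈ W) :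
    ∃ v ∈ W, IsSplitting J col v := by
  classical
  by_contra! hno
  obtain ⟨v, hv⟩ := hW
  -- Without splitting vertex, cusp-free simple paths can be prolonged for ever, which finiteness
  -- forbids. The condition that no prolongation comes back is what keeps the successive
  -- concatenations simple.
  have key : ∀ m : ℕ, ∃ p u, u ∈ W ∧ m ≤ p.length ∧ IsWalk J v p u ∧ (srcs p).Nodup ∧
      CuspFree col p ∧ ∀ q y, IsWalk J u q y → (srcs q).Nodup → CuspFree col q →
        NoCusp col p q → y ∉ srcs p := by
    intro m
    induction m with
    | zero => exact ⟨[], v, hv, by simp, rfl, by simp, by simp [CuspFree], by simp⟩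
    | succ m ih =>
      obtain ⟨p, u, hu, hm, hp, hpn, hpc, hpq⟩ := ih
      obtain ⟨r, w, hr, hr0, hrn, hwr, hrc, hpr, hrq⟩ :=
        exists_path_of_not_isSplitting hJ hac (hno u hu) p
      have hpos := List.length_pos_iff.2 hr0
      have hwW : w ∈ W := by
        obtain ⟨d, hd⟩ := Option.ne_none_iff_exists'.1 (fun h => hr0 (List.getLast?_eq_none_iff.1 h))
        rw [← hr.getLast_tgt d hd]
        exact hJW _ _ _ (hJ _ _ _ (hr.joins d (List.mem_of_getLast? hd)))
      refine ⟨p ++ r, w, hwW, by simp; omega, hp.append hr, ?_, cuspFree_append.2 ⟨hpc, hrc, hpr⟩, ?_⟩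
      · rw [srcs_append, List.nodup_append']
        refine ⟨hpn, hrn, fun x hx hx' => ?_⟩
        obtain ⟨r₁, r₂, rfl, h2, hw1, hw2⟩ := hr.exists_split hx'
        rw [srcs_append] at hrn
        refine hpq r₁ x hw1 hrn.of_append_left (cuspFree_append.1 hrc).1 ?_ hx
        rcases r₁ with _ | ⟨d, r₁⟩
        · simp [NoCusp]
        · rwa [noCusp_append_right (by simp)] at hpr
      · intro q y hq hqn hqc hprq hy
        rw [noCusp_append_left hr0] at hprq
        rw [srcs_append, List.mem_append] at hy
        rcases hy with hy | hy
        · refine hpq (r ++ q) y (hr.append hq) ?_ (cuspFree_append.2 ⟨hrc, hqc, hprq⟩)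
            ((noCusp_append_right hr0).2 hpr) hy
          rw [srcs_append, List.nodup_append']
          refine ⟨hrn, hqn, fun x hx hx' => ?_⟩
          obtain ⟨q₁, q₂, rfl, h2, hw1, hw2⟩ := hq.exists_split hx'
          rw [srcs_append] at hqn
          refine hrq q₁ x hw1 hqn.of_append_left (cuspFree_append.1 hqc).1 ?_ hx
          rcases q₁ with _ | ⟨d, q₁⟩
          · simp [NoCusp]
          · rwa [noCusp_append_right (by simp)] at hprq
        · exact hrq q y hq hqn hqc hprq hy
  obtain ⟨p, u, -, hm, hp, hpn, -, -⟩ := key (W.card + 1)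
  have hsub : (srcs p).toFinset ⊆ W := by
    intro x hx
    obtain ⟨d, hd, rfl⟩ := mem_srcs.1 (List.mem_toFinset.1 hx)
    exact hJW _ _ _ (hp.joins d hd)
  have := Finset.card_le_card hsub
  rw [List.toFinset_card_of_nodup hpn, srcs, List.length_map] at this
  omega

end EdgeDart

/-! ### A pair of vertices whose connecting paths stay on one side -/

namespace EdgeDart

variable {V E C : Type*} {J : E → V → V → Prop} {col : V → E → C}

/-- The multigraph induced on a set of vertices. -/
def within (J : E → V → V → Prop) (W : Finset V) : E → V → V → Prop :=
  fun x u w => u ∈ W ∧ w ∈ W ∧ J x u w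

theorem within_symm (hJ : ∀ x u w, J x u w → J x w u) (W : Finset V) (x : E) (u w : V)
    (h : within J W x u w) : within J W x w u :=
  ⟨h.2.1, h.1, hJ _ _ _ h.2.2⟩

theorem IsWalk.tgt_mem {u w : V} {l : List (EdgeDart V E)} (h : IsWalk J u l w)
    {d : EdgeDart V E} (hd : d ∈ l) : d.tgt = w ∨ d.tgt ∈ srcs l :=
  List.mem_cons.1 (h.perm.mem_iff.2 (List.mem_cons_of_mem _ (mem_srcs_revWalk.2 ⟨d, hd, rfl⟩)))

theorem IsWalk.within_erase [DecidableEq V] {W : Finset V} {u v w : V} {l : List (EdgeDart V E)}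
    (h : IsWalk (within J W) u l w) (hv : v ∉ srcs l) (hw : w ≠ v) :
    IsWalk (within J (W.erase v)) u l w := by
  refine h.mono fun d hd ⟨h1, h2, h3⟩ => ⟨Finset.mem_erase.2 ⟨?_, h1⟩, Finset.mem_erase.2 ⟨?_, h2⟩, h3⟩
  · rintro rfl
    exact hv (mem_srcs.2 ⟨d, hd, rfl⟩)
  · rintro rfl
    rcases h.tgt_mem hd with h | h
    · exact hw h.symm
    · exact hv h

theorem IsWalk.of_within {W : Finset V} {u w : V} {l : List (EdgeDart V E)}
    (h : IsWalk (within J W) u l w) : IsWalk J u l w :=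
  h.mono fun _ _ h => h.2.2

/-- All the edges which join a splitting vertex to a connected component of its complement have the
same colour at that vertex. -/
theorem IsSplitting.color_eq [DecidableEq V] {W : Finset V} {v : V}
    (hv : IsSplitting (within J W) col v) {x x' : E} {y y' : V}
    (hx : within J W x v y) (hx' : within J W x' y' v) (hy' : y' ≠ v) {l : List (EdgeDart V E)}
    (hl : IsWalk (within J (W.erase v)) y l y') : col v x = col v x' := by
  obtain ⟨l, hl, hn, hy⟩ := hl.exists_simple
  have hl' : IsWalk (within J W) y l y' := hl.mono fun d _ ⟨h1, h2, h3⟩ =>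
    ⟨Finset.mem_of_mem_erase h1, Finset.mem_of_mem_erase h2, h3⟩
  have hvl : v ∉ srcs l := by
    intro h
    obtain ⟨d, hd, rfl⟩ := mem_srcs.1 h
    exact (Finset.mem_erase.1 (hl.joins d hd).1).1 rfl
  -- The path in the complement, closed up by `x` and `x'`, is a simple closed walk at `v`, so it
  -- has a cusp at `v`.
  have := hv (⟨v, x, y⟩ :: (l ++ [⟨y', x', v⟩])) ⟨rfl, hx, hl'.append (.single (d := ⟨y', x', v⟩) hx')⟩ ?_ (by simp)
  · rw [← List.cons_append, noCusp_append_left (by simp)] at this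
    by_contra hne
    refine this fun d hd d' hd' => ?_
    simp only [List.getLast?_singleton, Option.mem_def, Option.some.injEq, List.cons_append,
      List.head?_cons] at hd hd'
    subst hd hd'
    exact Ne.symm hne
  · simp only [srcs_cons, srcs_append, srcs_nil, List.nodup_cons, List.mem_append, List.mem_singleton,
      not_or]
    refine ⟨⟨hvl, hy'.symm⟩, ?_⟩
    rw [List.nodup_append']
    exact ⟨hn, by simp, by simpa using hy⟩

/-- A map on edges which is constant around the inner vertices of a walk is constant along it. -/
theorem IsWalk.side_eq {σ : Type*} {S : E → σ} {K : Set V} (hJ : ∀ x u w, J x u w → J x w u)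
    (hS : ∀ x y u w w', J x u w → J y u w' → u ∉ K → S x = S y) {u w : V}
    {l : List (EdgeDart V E)} (h : IsWalk J u l w) (hK : ∀ d ∈ l.tail, d.src ∉ K) :
    ∀ d ∈ l, ∀ d' ∈ l, S d.edge = S d'.edge := by
  suffices ∀ d ∈ l.head?, ∀ d' ∈ l, S d'.edge = S d.edge by
    rcases l with _ | ⟨d₀, l⟩
    · simp
    · intro d hd d' hd'
      rw [this d₀ rfl d hd, this d₀ rfl d' hd']
  induction l generalizing u with
  | nil => simp
  | cons d l ih =>
    obtain ⟨rfl, hd, h⟩ := h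
    simp only [List.head?_cons, Option.mem_def, Option.some.injEq, forall_eq', List.mem_cons,
      forall_eq_or_imp, true_and]
    intro d' hd'
    rcases l with _ | ⟨d₁, l⟩
    · simp at hd'
    · rw [ih h (fun a ha => hK a (by simpa using .inr ha)) d₁ rfl d' hd']
      have h1 := h.1
      refine (hS _ _ d₁.src d.src _ ?_ h.2.1 (hK d₁ (by simp))).symm
      rw [h1]
      exact hJ _ _ _ hd

/-- Let the edges of a multigraph without cusp-free cycle be divided into sides by the vertices of
`K`. If `K` has at least two elements, then two of them are such that all cusp-free paths between
them begin and end on the same given side. -/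
theorem exists_pair {σ : Type*} (S : E → σ) (K : Set V) (hJ : ∀ x u w, J x u w → J x w u)
    (hac : CuspAcyclic J col)
    (hS : ∀ x y u w w', J x u w → J y u w' → u ∉ K → S x = S y)
    (hcol : ∀ x y u w w', J x u w → J y u w' → col u x = col u y → S x = S y)
    (s₀ : σ) (W : Finset V) (hK : ∃ c ∈ W, ∃ c' ∈ W, c ∈ K ∧ c' ∈ K ∧ c ≠ c') :
    ∃ c ∈ W, ∃ c' ∈ W, c ∈ K ∧ c' ∈ K ∧ c ≠ c' ∧ ∃ s, ∀ l, IsWalk (within J W) c l c' →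
      (srcs l).Nodup → c' ∉ srcs l → CuspFree col l →
      (∀ d ∈ l.head?, S d.edge = s) ∧ ∀ d ∈ l.getLast?, S d.edge = s := by
  classical
  induction W using Finset.strongInduction with
  | H W ih =>
  obtain ⟨c, hc, c', hc', hcK, hcK', hne⟩ := hK
  have hacW : CuspAcyclic (within J W) col := fun v l h => hac v l h.of_within
  have hJW := within_symm hJ W
  obtain ⟨v, hvW, hv⟩ := exists_isSplitting hJW hacW W ⟨c, hc⟩ fun _ _ _ h => h.1
  -- Does some component of the complement of `v` contain two elements of `K`? If so, the induction
  -- hypothesis is applied to that component.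
  by_cases hA : ∃ c ∈ W.erase v, ∃ c' ∈ W.erase v, c ∈ K ∧ c' ∈ K ∧ c ≠ c' ∧
      ∃ l, IsWalk (within J (W.erase v)) c l c'
  · obtain ⟨c, hc, c', hc', hcK, hcK', hne, l₀, hl₀⟩ := hA
    set W' := (W.erase v).filter fun x => ∃ l, IsWalk (within J (W.erase v)) c l x with hW'
    have hsub : W' ⊂ W := by
      refine Finset.ssubset_of_subset_of_ssubset (Finset.filter_subset _ _) ?_
      exact Finset.erase_ssubset hvW
    obtain ⟨d₁, hd₁, d₂, hd₂, hdK₁, hdK₂, hd, s, hs⟩ := ih W' hsub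
      ⟨c, Finset.mem_filter.2 ⟨hc, [], rfl⟩, c', Finset.mem_filter.2 ⟨hc', l₀, hl₀⟩, hcK, hcK', hne⟩
    refine ⟨d₁, hsub.1 hd₁, d₂, hsub.1 hd₂, hdK₁, hdK₂, hd, s, fun l hl hn hln hcf => ?_⟩
    obtain ⟨he₁, m₁, hm₁⟩ := Finset.mem_filter.1 hd₁
    obtain ⟨he₂, m₂, hm₂⟩ := Finset.mem_filter.1 hd₂
    refine hs l ?_ hn hln hcf
    -- A path through `v` would leave the component and enter it again by two edges of the same
    -- colour at `v`, hence with a cusp.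
    by_cases hvl : v ∈ srcs l
    · exfalso
      obtain ⟨l₁, l₂, rfl, h2, hw1, hw2⟩ := hl.exists_split hvl
      have h1 : l₁ ≠ [] := by
        rintro rfl
        exact (Finset.mem_erase.1 he₁).1 hw1
      rw [srcs_append, List.nodup_append'] at hn
      obtain ⟨-, -, hnc⟩ := cuspFree_append.1 hcf
      obtain ⟨l₁, a, rfl⟩ := List.eq_nil_or_concat l₁ |>.resolve_left h1
      rcases l₂ with _ | ⟨b, l₂⟩
      · exact h2 rfl
      rw [List.concat_eq_append] at *
      obtain ⟨z, hz, haz, ha, hav⟩ := isWalk_append.1 hw1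
      obtain ⟨hbv, hb, hbw⟩ := hw2
      subst haz
      have hav' : a.tgt = v := hav
      subst hav'
      have hva : a.src ≠ a.tgt := by
        intro h
        exact hn.2.2 (show a.tgt ∈ _ by simp [h]) (by simp [hbv])
      have hn2 := hn.2.1
      rw [srcs_cons, List.nodup_cons, hbv] at hn2
      have hz' := hz.within_erase (v := a.tgt) (fun h => hn.2.2 (show a.tgt ∈ _ by simp [h])
        (by simp [hbv])) hva
      have hb' := hbw.within_erase hn2.1 (Finset.mem_erase.1 he₂).1
      have hJe := within_symm hJ (W.erase a.tgt)
      have hwalk := ((hb'.append (hm₂.revWalk hJe)).append hm₁).append hz'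
      rw [hbv] at hb
      refine hnc a (by simp) b (by simp) ?_
      rw [hbv]
      exact (hv.color_eq hb ha hva hwalk).symm
    · have hl' := hl.within_erase hvl (Finset.mem_erase.1 he₂).1
      refine hl'.mono fun d hd h => ?_
      obtain ⟨k₁, k₂, rfl⟩ := List.append_of_mem hd
      obtain ⟨z, hz, hz1, hz2, hz3⟩ := isWalk_append.1 hl'
      subst hz1
      refine ⟨Finset.mem_filter.2 ⟨h.1, _, hm₁.append hz⟩, Finset.mem_filter.2 ⟨h.2.1, _,
        (hm₁.append hz).append (.single h)⟩, h.2.2⟩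
  · push Not at hA
    have hB : ∀ c ∈ W, ∀ c' ∈ W, c ∈ K → c' ∈ K → ∀ l, IsWalk (within J W) c l c' →
        v ∉ srcs l → c ≠ v → c' ≠ v → c = c' := by
      intro c hc c' hc' hcK hcK' l hl hvl hcv hcv'
      by_contra hne
      exact hA c (Finset.mem_erase.2 ⟨hcv, hc⟩) c' (Finset.mem_erase.2 ⟨hcv', hc'⟩) hcK hcK' hne l
        (hl.within_erase hvl hcv')
    have hSW : ∀ x y u w w', within J W x u w → within J W y u w' → u ∉ K → S x = S y :=
      fun x y u w w' h h' => hS x y u w w' h.2.2 h'.2.2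
    -- From here on each component of the complement of `v` contains at most one element of `K`. If
    -- `v` is in `K`, any other element `c` is paired with it: all paths leave `v` in the colour of
    -- the component of `c`, hence on the same side, and have no inner vertex in `K`.
    by_cases hvK : v ∈ K
    · obtain ⟨c, hc, hcK, hcv⟩ : ∃ c ∈ W, c ∈ K ∧ c ≠ v := by
        by_cases h : c = v
        · exact ⟨c', hc', hcK', fun h' => hne (h.trans h'.symm)⟩
        · exact ⟨c, hc, hcK, h⟩
      refine ⟨v, hvW, c, hc, hvK, hcK, hcv.symm, ?_⟩
      by_cases hex : ∃ d l, IsWalk (within J W) v (d :: l) c ∧ v ∉ srcs l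
      · obtain ⟨d₀, l₀, ⟨h01, h02, h03⟩, hv0⟩ := hex
        refine ⟨S d₀.edge, fun l hl hn hcl hcf => ?_⟩
        rcases l with _ | ⟨d, l⟩
        · exact absurd hl.symm hcv
        have hl' := hl
        obtain ⟨h1, h2, h3⟩ := hl
        rw [srcs_cons, List.nodup_cons, h1] at hn
        have hside := hl'.side_eq (K := K) hJW hSW (fun b hb hbK => by
          obtain ⟨k₁, k₂, rfl⟩ := List.append_of_mem (show b ∈ l from hb)
          obtain ⟨z, hz, hz1, hz2, hz3⟩ := isWalk_append.1 h3
          subst hz1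
          have hbv : b.src ≠ v := by
            rintro h
            exact hn.1 (by simp [h])
          have := hB b.src hz2.1 c hc hbK hcK (b :: k₂) ⟨rfl, hz2, hz3⟩
            (fun h => hn.1 (by simp only [srcs_append, List.mem_append]; exact .inr h)) hbv hcv
          exact hcl (by simp [this]))
        have hd : S d.edge = S d₀.edge := by
          rw [h1] at h2
          rw [h01] at h02
          refine hcol _ _ v _ _ h2.2.2 h02.2.2 ?_
          have ht : d₀.tgt ≠ v := by
            intro h
            rcases l₀ with _ | ⟨d₁, l₀⟩
            · exact hcv (h03.symm.trans h)
            · exact hv0 (by simp [h03.1, h])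
          exact hv.color_eq h2 (hJW _ _ _ h02) ht ((h3.within_erase hn.1 hcv).append
            ((h03.within_erase hv0 hcv).revWalk (within_symm hJ _)))
        exact ⟨fun a ha => (hside a (List.mem_of_mem_head? ha) d (by simp)).trans hd,
          fun a ha => (hside a (List.mem_of_getLast? ha) d (by simp)).trans hd⟩
      -- There is no path at all, so any side will do; `s₀` only serves as a default.
      · refine ⟨s₀, fun l hl hn hcl hcf => ?_⟩
        rcases l with _ | ⟨d, l⟩
        · exact absurd hl.symm hcv
        · rw [srcs_cons, List.nodup_cons, hl.1] at hn
          exact absurd ⟨d, l, hl, hn.1⟩ hex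
    · refine ⟨c, hc, c', hc', hcK, hcK', hne, ?_⟩
      have hcv : c ≠ v := fun h => hvK (h ▸ hcK)
      have hcv' : c' ≠ v := fun h => hvK (h ▸ hcK')
      -- Here `c` and `c'` lie in different components, so every path between them crosses `v`. As
      -- `v` is not in `K`, its edges all lie on one side, and so does the whole path.
      obtain ⟨s, hs⟩ : ∃ s, ∀ x w, within J W x v w → S x = s := by
        by_cases h : ∃ x w, within J W x v w
        · obtain ⟨x, w, h⟩ := h
          exact ⟨S x, fun y w' h' => hSW _ _ _ _ _ h' h hvK⟩
        · push Not at h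
          exact ⟨s₀, fun x w h' => absurd h' (h x w)⟩
      refine ⟨s, fun l hl hn hcl hcf => ?_⟩
      have hvl : v ∈ srcs l := by
        by_contra hvl
        exact hne (hB c hc c' hc' hcK hcK' l hl hvl hcv hcv')
      obtain ⟨l₁, l₂, rfl, h2, hw1, hw2⟩ := hl.exists_split hvl
      rcases l₂ with _ | ⟨b, l₂⟩
      · exact absurd rfl h2
      have hbv := hw2.1
      rw [srcs_append, List.nodup_append'] at hn
      obtain ⟨hn1, hn2, hn12⟩ := hn
      rw [srcs_cons, List.nodup_cons, hbv] at hn2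
      have hv1 : v ∉ srcs l₁ := fun h => hn12 h (by simp [hbv])
      have hside := hl.side_eq (K := K) hJW hSW (fun a ha haK => by
        rcases l₁ with _ | ⟨a₁, l₁⟩
        · exact hcv hw1
        rw [List.cons_append, List.tail_cons, List.mem_append] at ha
        rcases ha with ha | ha
        · obtain ⟨k₁, k₂, rfl⟩ := List.append_of_mem ha
          rw [← List.cons_append] at hw1
          obtain ⟨z, hz, hz1, hz2, hz3⟩ := isWalk_append.1 hw1
          subst hz1
          rw [← List.cons_append, srcs_append, List.mem_append, not_or] at hv1
          have := hB c hc a.src hz2.1 hcK haK _ hz hv1.1 hcv fun h => hv1.2 (by simp [h])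
          rw [← List.cons_append, srcs_append, List.nodup_append'] at hn1
          exact hn1.2.2 (show c ∈ _ by simp [hz.1]) (by simp [this])
        · rcases List.mem_cons.1 ha with rfl | ha
          · exact hvK (hbv ▸ haK)
          · obtain ⟨k₁, k₂, rfl⟩ := List.append_of_mem ha
            obtain ⟨z, hz, hz1, hz2, hz3⟩ := isWalk_append.1 hw2.2.2
            subst hz1
            have := hB a.src hz2.1 c' hc' haK hcK' (a :: k₂) ⟨rfl, hz2, hz3⟩
              (fun h => hn2.1 (by simp only [srcs_append, List.mem_append]; exact .inr h))
              (fun h => hn2.1 (by simp [h])) hcv'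
            exact hcl (by simp [this]))
      have hb : S b.edge = s := by
        have := hw2.2.1
        rw [hbv] at this
        exact hs _ _ this
      exact ⟨fun a ha => (hside a (List.mem_of_mem_head? ha) b (by simp)).trans hb,
        fun a ha => (hside a (List.mem_of_getLast? ha) b (by simp)).trans hb⟩

end EdgeDart

/-! ### Expansion of a coloured multigraph -/

namespace EdgeDart

variable {V E C C' : Type*} {J J' : E → V → V → Prop} {col : V → E → C} {col' : V → E → C'}

/-- After a rotation `x` is the base point, where the first and last edges have different colours.
This serves to show that a cusp-free cycle avoids a vertex whose available edges share one colour.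
-/
theorem exists_darts_at {v x : V} {l : List (EdgeDart V E)} (h : IsWalk J v l v)
    (hn : (srcs l).Nodup) (hc : CuspFree col l) (hv : NoCusp col l l) (hx : x ∈ srcs l) :
    ∃ d ∈ l, ∃ d' ∈ l, d.tgt = x ∧ d'.src = x ∧ col x d.edge ≠ col x d'.edge := by
  obtain ⟨l', h1, -, h3, -, h5, h6⟩ := exists_rotate h hn hc hv hx
  obtain ⟨d', hd'⟩ := Option.ne_none_iff_exists'.1 (fun h => h3 (List.head?_eq_none_iff.1 h))
  obtain ⟨d, hd⟩ := Option.ne_none_iff_exists'.1 (fun h => h3 (List.getLast?_eq_none_iff.1 h))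
  have e1 := h1.getLast_tgt d hd
  have e2 := h1.head_src d' hd'
  refine ⟨d, h6.mem_iff.1 (List.mem_of_getLast? hd), d', h6.mem_iff.1 (List.mem_of_mem_head? hd'),
    e1, e2, ?_⟩
  have := h5 d hd d' hd'
  rwa [e1, e2] at this

theorem IsWalk.closed_tgt_mem {v : V} {l : List (EdgeDart V E)} (h : IsWalk J v l v)
    {d : EdgeDart V E} (hd : d ∈ l) : d.tgt ∈ srcs l := by
  rcases h.tgt_mem hd with h' | h'
  · rw [h']
    exact h.start_mem_srcs (List.ne_nil_of_mem hd)
  · exact h'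

theorem CuspFree.congr {l : List (EdgeDart V E)} {v w : V} (h : CuspFree col' l)
    (hw : IsWalk J v l w) (hP : ∀ d ∈ l, ∀ d' ∈ l, d.tgt = d'.src →
      col d.tgt d.edge = col d'.src d'.edge → col' d.tgt d.edge = col' d'.src d'.edge) :
    CuspFree col l := by
  induction l generalizing v with
  | nil => simp [CuspFree]
  | cons d l ih =>
    have h' : CuspFree col' ([d] ++ l) := h
    rw [cuspFree_append] at h'
    refine (cuspFree_append (l := [d])).2 ⟨by simp [CuspFree],
      ih h'.2.1 hw.2.2 fun a ha b hb => hP a (by simp [ha]) b (by simp [hb]), ?_⟩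
    intro a ha b hb hab
    have hda : a = d := by simpa using ha.symm
    exact h'.2.2 a ha b hb (hP a (by simp [hda]) b
      (List.mem_cons_of_mem _ (List.mem_of_mem_head? hb)) (by
        rw [hda, hw.2.2.head_src b hb]) hab)

/-- Colours are compared at inner vertices only, so the outer ends of the first and last edges may
be moved, as happens when `t` becomes `c₁`. -/
theorem CuspFree.replace_ends {h h' g g' : EdgeDart V E} {m : List (EdgeDart V E)}
    (hcf : CuspFree col' (h :: (m ++ [g]))) (he : h'.edge = h.edge) (ht : h'.tgt = h.tgt)
    (ge : g'.edge = g.edge) (gs : g'.src = g.src)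
    (hP : ∀ v ∈ srcs (m ++ [g]), ∀ x y, col v x = col v y → col' v x = col' v y)
    {v w : V} (hw : IsWalk J v (h :: (m ++ [g])) w) :
    CuspFree col (h' :: (m ++ [g'])) := by
  induction m generalizing h h' v with
  | nil =>
    obtain ⟨-, -, hg, -, -⟩ := hw
    have hn := List.isChain_pair.1 hcf
    refine List.isChain_pair.2 fun hh => hn ?_
    rw [he, ht, ge, gs, ← hg] at hh
    rw [← hg]
    exact hP g.src (by simp) _ _ hh
  | cons d m ih =>
    have hd : d.src = h.tgt := hw.2.2.1
    obtain ⟨hn, hc⟩ := List.isChain_cons_cons.1 hcf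
    refine List.isChain_cons_cons.2 ⟨fun hh => hn ?_, ih hc rfl rfl
      (fun v hv => hP v (List.mem_cons_of_mem _ hv)) hw.2.2⟩
    rw [he, ht, ← hd] at hh
    rw [← hd]
    exact hP d.src (by simp) _ _ hh

/-- `J'` is obtained from `J` by deleting the vertices `c₁`, joined to the rest by the edges `a` and
`a'`, and `c₂`, joined to the rest by `b` and `b'`, and adding the vertices `t`, incident to
`a, b, e`, `p`, incident to `a', b', f`, and `c`, incident to `e, f`. The edges `a', b'` have the
same colour at `p`. -/
structure IsExpansion (J J' : E → V → V → Prop) (col : V → E → C) (col' : V → E → C')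
    (c t p : V) (e f a b a' b' : E) (c₁ c₂ : V) : Prop where
  symm : ∀ x u w, J x u w → J x w u
  symm' : ∀ x u w, J' x u w → J' x w u
  c_adj : ∀ x w, J' x c w → (x = e ∧ w = t) ∨ (x = f ∧ w = p)
  t_adj : ∀ x w, J' x t w → (x = a ∧ J a c₁ w ∧ w ≠ c₁ ∧ w ≠ c₂) ∨
    (x = b ∧ J b c₂ w ∧ w ≠ c₁ ∧ w ≠ c₂) ∨ (x = e ∧ w = c)
  p_adj : ∀ x w, J' x p w → (x = a' ∧ J a' c₁ w ∧ w ≠ c₁ ∧ w ≠ c₂) ∨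
    (x = b' ∧ J b' c₂ w ∧ w ≠ c₁ ∧ w ≠ c₂) ∨ (x = f ∧ w = c)
  old : ∀ x u w, J' x u w → u ≠ c → u ≠ t → u ≠ p → w ≠ c → w ≠ t → w ≠ p →
    J x u w ∧ u ≠ c₁ ∧ u ≠ c₂
  fresh : ∀ x u w, J x u w → u ≠ c ∧ u ≠ t ∧ u ≠ p
  col_old : ∀ v x, v ≠ c → v ≠ t → v ≠ p → ∀ y, col v x = col v y → col' v x = col' v y
  col_p : col' p a' = col' p b'
  col₁ : col c₁ a ≠ col c₁ a'
  col₂ : col c₂ b ≠ col c₂ b'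
  c_ne_t : c ≠ t
  e_ne_a : e ≠ a
  e_ne_b : e ≠ b
  a_ne_b : a ≠ b
  c₁_ne_c₂ : c₁ ≠ c₂

namespace IsExpansion

variable {c t p : V} {e f a b a' b' : E} {c₁ c₂ : V}

/-- The two cuts play symmetric roles, so only cycles which leave `t` along `a` need a separate
treatment. -/
theorem swap (h : IsExpansion J J' col col' c t p e f a b a' b' c₁ c₂) :
    IsExpansion J J' col col' c t p e f b a b' a' c₂ c₁ where
  symm := h.symm
  symm' := h.symm'
  c_adj := h.c_adj
  t_adj x w hx := by have := h.t_adj x w hx; tauto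
  p_adj x w hx := by have := h.p_adj x w hx; tauto
  old x u w k1 k2 k3 k4 k5 k6 k7 := by have := h.old x u w k1 k2 k3 k4 k5 k6 k7; tauto
  fresh := h.fresh
  col_old := h.col_old
  col_p := h.col_p.symm
  col₁ := h.col₂
  col₂ := h.col₁
  c_ne_t := h.c_ne_t
  e_ne_a := h.e_ne_b
  e_ne_b := h.e_ne_a
  a_ne_b := h.a_ne_b.symm
  c₁_ne_c₂ := h.c₁_ne_c₂.symm

/-- A path which leaves `t` along `a` and stays in the old part is carried over to a path from
`c₁`. -/
theorem lift (h : IsExpansion J J' col col' c t p e f a b a' b' c₁ c₂)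
    {d g : EdgeDart V E} {m : List (EdgeDart V E)} {v w : V}
    (hw : IsWalk J' t (d :: (m ++ [g])) v) (hd : d.edge = a)
    (hnew : ∀ x ∈ srcs (m ++ [g]), x ≠ c ∧ x ≠ t ∧ x ≠ p) (hn : (srcs (m ++ [g])).Nodup)
    (hcf : CuspFree col' (d :: (m ++ [g]))) (hg : J g.edge w g.src) (hgc : g.src ≠ c₁ ∧ g.src ≠ c₂) :
    IsWalk J c₁ (⟨c₁, a, d.tgt⟩ :: (m ++ [⟨g.src, g.edge, w⟩])) w ∧
    (srcs (⟨c₁, a, d.tgt⟩ :: (m ++ [(⟨g.src, g.edge, w⟩ : EdgeDart V E)]))).Nodup ∧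
    CuspFree col (⟨c₁, a, d.tgt⟩ :: (m ++ [⟨g.src, g.edge, w⟩])) ∧
    c₂ ∉ srcs (⟨c₁, a, d.tgt⟩ :: (m ++ [(⟨g.src, g.edge, w⟩ : EdgeDart V E)])) := by
  have hcf' : CuspFree col (⟨c₁, a, d.tgt⟩ :: (m ++ [⟨g.src, g.edge, w⟩])) := by
    refine hcf.replace_ends hd.symm rfl rfl rfl ?_ hw
    intro x hx y z hyz
    obtain ⟨k1, k2, k3⟩ := hnew x hx
    exact h.col_old x y k1 k2 k3 z hyz
  obtain ⟨hds, hdJ, hmg⟩ := hw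
  obtain ⟨z, hm, rfl, hgJ, -⟩ := isWalk_append.1 hmg
  rw [hds, hd] at hdJ
  have hya : J a c₁ d.tgt := by
    rcases h.t_adj _ _ hdJ with hh | hh | hh
    · exact hh.2.1
    · exact absurd hh.1 h.a_ne_b
    · exact absurd hh.1.symm h.e_ne_a
  have hmJ : ∀ d' ∈ m, J d'.edge d'.src d'.tgt ∧ d'.src ≠ c₁ ∧ d'.src ≠ c₂ := by
    intro d' hd'
    obtain ⟨k1, k2, k3⟩ := hnew d'.src (mem_srcs.2 ⟨d', by simp [hd'], rfl⟩)
    obtain ⟨k4, k5, k6⟩ := hnew d'.tgt (by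
      rcases hm.tgt_mem hd' with hh | hh
      · simp [hh]
      · simp [hh])
    exact h.old _ _ _ (hm.joins d' hd') k1 k2 k3 k4 k5 k6
  have hs : srcs (⟨c₁, a, d.tgt⟩ :: (m ++ [(⟨g.src, g.edge, w⟩ : EdgeDart V E)])) =
      c₁ :: srcs (m ++ [g]) := by simp
  have hms : ∀ x ∈ srcs (m ++ [g]), x ≠ c₁ ∧ x ≠ c₂ := by
    intro x hx
    rw [srcs_append, List.mem_append] at hx
    rcases hx with hx | hx
    · obtain ⟨d', hd', rfl⟩ := mem_srcs.1 hx
      exact (hmJ d' hd').2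
    · have : x = g.src := by simpa using hx
      rwa [this]
  refine ⟨⟨rfl, hya, (hm.mono fun d' hd' _ => (hmJ d' hd').1).append
    (.single (d := ⟨g.src, g.edge, w⟩) (h.symm _ _ _ hg))⟩, ?_, hcf', ?_⟩
  · rw [hs, List.nodup_cons]
    exact ⟨fun hh => (hms _ hh).1 rfl, hn⟩
  · rw [hs, List.mem_cons, not_or]
    exact ⟨h.c₁_ne_c₂.symm, fun hh => (hms _ hh).2 rfl⟩

/-- The edge `f` leads to `c`; the other edges at `p` are `a'` and `b'`, which have the same colour
there. -/
theorem not_two_at_p (h : IsExpansion J J' col col' c t p e f a b a' b' c₁ c₂) {v : V}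
    {l : List (EdgeDart V E)} (hw : IsWalk J' v l v) {x y : EdgeDart V E} (hx : x ∈ l) (hy : y ∈ l)
    (hxp : x.tgt = p) (hyp : y.src = p) (hxy : col' p x.edge ≠ col' p y.edge) (hc : c ∉ srcs l) :
    False := by
  have hxJ := h.symm' _ _ _ (hw.joins x hx)
  have hyJ := hw.joins y hy
  rw [hxp] at hxJ
  rw [hyp] at hyJ
  have hxc : x.src ≠ c := fun hh => hc (mem_srcs.2 ⟨x, hx, hh⟩)
  have hyc : y.tgt ≠ c := fun hh => hc (hh ▸ hw.closed_tgt_mem hy)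
  have key : ∀ z w, J' z p w → w ≠ c → col' p z = col' p a' := by
    intro z w hz hw
    rcases h.p_adj _ _ hz with ⟨k, -⟩ | ⟨k, -⟩ | ⟨-, k⟩
    · rw [k]
    · rw [k, h.col_p]
    · exact absurd k hw
  exact hxy ((key _ _ hxJ hxc).trans (key _ _ hyJ hyc).symm)

/-- No cusp-free cycle of the expansion leaves `t` along `a`. -/
theorem not_cycle_through_a (h : IsExpansion J J' col col' c t p e f a b a' b' c₁ c₂)
    (hac : CuspAcyclic J col)
    (hgood : ∀ l, IsWalk J c₁ l c₂ → (srcs l).Nodup → c₂ ∉ srcs l → CuspFree col l →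
      ∀ d ∈ l.head?, d.edge ≠ a)
    {d : EdgeDart V E} {r : List (EdgeDart V E)} (hw : IsWalk J' t (d :: r) t)
    (hn : (srcs (d :: r)).Nodup) (hcf : CuspFree col' (d :: r))
    (hnc : NoCusp col' (d :: r) (d :: r)) (hd : d.edge = a) : False := by
  have hds : d.src = t := hw.1
  have hya : J a c₁ d.tgt := by
    have := hw.2.1
    rw [hds, hd] at this
    rcases h.t_adj _ _ this with hh | hh | hh
    · exact hh.2.1
    · exact absurd hh.1 h.a_ne_b
    · exact absurd hh.1.symm h.e_ne_a
  obtain ⟨hyc, hyt, hyp⟩ := h.fresh _ _ _ (h.symm _ _ _ hya)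
  rcases List.eq_nil_or_concat r with rfl | ⟨m, g, rfl⟩
  · exact hyt hw.2.2
  rw [List.concat_eq_append] at *
  obtain ⟨z, hm, rfl, hgJ, hgt⟩ := isWalk_append.1 hw.2.2
  have hgt : g.tgt = t := hgt
  have hne : col' t g.edge ≠ col' t a := by
    rw [← List.cons_append, noCusp_append_left (by simp)] at hnc
    have := hnc g (by simp) d (by simp)
    rwa [hgt, hds, hd] at this
  have hgJ' := h.symm' _ _ _ hgJ
  rw [hgt] at hgJ'
  have hn' := hn
  rw [srcs_cons, List.nodup_cons, hds] at hn'
  have hnt : ∀ x ∈ srcs (m ++ [g]), x ≠ t := by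
    rintro x hx rfl
    exact hn'.1 hx
  -- The cycle comes back to `t` along `a`, which is a cusp, along `b`, or along `e`. In the second
  -- case it avoids `c` and `p` and lifts to a path from `c₁` to `c₂` which begins with `a`.
  rcases h.t_adj _ _ hgJ' with ⟨hg, -⟩ | ⟨hg, hgb, hg1⟩ | ⟨hg, hgc⟩
  · exact hne (by rw [hg])
  · have ht : ∀ x ∈ d :: (m ++ [g]), x.src = t ∨ x.tgt = t → x.edge ≠ e := by
      intro x hx hxt
      simp only [List.mem_cons, List.mem_append, List.not_mem_nil, or_false] at hx
      rcases hx with rfl | hx | rfl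
      · rw [hd]
        exact h.e_ne_a.symm
      · exfalso
        rcases hxt with hxt | hxt
        · exact hnt x.src (mem_srcs.2 ⟨x, by simp [hx], rfl⟩) hxt
        · refine hnt x.tgt ?_ hxt
          rcases hm.tgt_mem hx with hh | hh <;> simp [hh]
      · rw [hg]
        exact h.e_ne_b.symm
    have hc : c ∉ srcs (d :: (m ++ [g])) := by
      intro hcm
      obtain ⟨x, hx, y, hy, hxc, hyc, hxy⟩ := exists_darts_at hw hn hcf hnc hcm
      have hxJ := h.symm' _ _ _ (hw.joins x hx)
      have hyJ := hw.joins y hy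
      rw [hxc] at hxJ
      rw [hyc] at hyJ
      rcases h.c_adj _ _ hxJ with ⟨k1, k2⟩ | ⟨k1, k2⟩
      · exact ht x hx (.inl k2) k1
      · rcases h.c_adj _ _ hyJ with ⟨k3, k4⟩ | ⟨k3, k4⟩
        · exact ht y hy (.inr k4) k3
        · exact hxy (by rw [k1, k3])
    have hp : p ∉ srcs (d :: (m ++ [g])) := by
      intro hpm
      obtain ⟨x, hx, y, hy, hxp, hyp, hxy⟩ := exists_darts_at hw hn hcf hnc hpm
      exact h.not_two_at_p hw hx hy hxp hyp hxy hc
    rw [srcs_cons, List.mem_cons, not_or] at hc hp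
    rw [← hg] at hgb
    obtain ⟨k1, k2, k3, k4⟩ := h.lift hw hd (fun x hx => ⟨fun hh => hc.2 (hh ▸ hx), hnt x hx,
      fun hh => hp.2 (hh ▸ hx)⟩) hn'.2 hcf hgb hg1
    exact hgood _ k1 k2 k4 k3 _ rfl rfl
  -- If the cycle comes back along `e`, it has just crossed `p` and `c`. The three last edges are
  -- removed one by one to find how `p` was reached.
  · rcases List.eq_nil_or_concat m with rfl | ⟨m, g₂, rfl⟩
    · exact hyc (hm.trans hgc)
    rw [List.concat_eq_append] at *
    obtain ⟨z, hm, rfl, hgJ2, hgt2⟩ := isWalk_append.1 hm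
    have hgt2 : g₂.tgt = c := Eq.trans hgt2 hgc
    have hgJ2 := h.symm' _ _ _ hgJ2
    rw [hgt2] at hgJ2
    rcases h.c_adj _ _ hgJ2 with ⟨-, k⟩ | ⟨-, hgp⟩
    · exact hnt _ (by simp) k
    rcases List.eq_nil_or_concat m with rfl | ⟨m, g₃, rfl⟩
    · exact hyp (Eq.trans hm hgp)
    rw [List.concat_eq_append] at *
    have hm' := hm
    obtain ⟨z, hm, rfl, hgJ3, hgt3⟩ := isWalk_append.1 hm'
    have hgt3 : g₃.tgt = p := Eq.trans hgt3 hgp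
    have hgJ3 := h.symm' _ _ _ hgJ3
    rw [hgt3] at hgJ3
    have hcf3 : CuspFree col' (d :: (m ++ [g₃])) := by
      have e : d :: (m ++ [g₃] ++ [g₂] ++ [g]) = (d :: (m ++ [g₃])) ++ [g₂, g] := by simp
      rw [e, cuspFree_append] at hcf
      exact hcf.1
    have hn3 := hn'.2
    rw [srcs_append, srcs_append, List.append_assoc, List.nodup_append'] at hn3
    obtain ⟨hn3, -, hn3'⟩ := hn3
    have hnew : ∀ x ∈ srcs (m ++ [g₃]), x ≠ c ∧ x ≠ t ∧ x ≠ p := by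
      intro x hx
      refine ⟨?_, hnt x (by rw [srcs_append, srcs_append]; simp only [List.mem_append, hx, true_or]), ?_⟩
      · rintro rfl
        exact hn3' hx (by simp [hgc])
      · rintro rfl
        exact hn3' hx (by simp [hgp])
    have hw3 : IsWalk J' t (d :: (m ++ [g₃])) g₂.src := ⟨hds, hw.2.1, hm'⟩
    -- If `p` was reached along `a'`, the lift closes up at `c₁`, where `a` and `a'` differ in
    -- colour: an old cusp-free cycle. If along `b'`, it is a path from `c₁` to `c₂` beginning with
    -- `a`.
    rcases h.p_adj _ _ hgJ3 with ⟨k, k0, kn⟩ | ⟨k, k0, kn⟩ | ⟨-, k⟩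
    · rw [← k] at k0
      obtain ⟨k1, k2, k3, k4⟩ := h.lift hw3 hd hnew hn3 hcf3 k0 kn
      refine hac _ _ k1 k2 (by simp) k3 ?_
      rw [← List.cons_append, noCusp_append_left (by simp)]
      intro x hx y hy
      simp only [List.getLast?_singleton, Option.mem_def, Option.some.injEq, List.cons_append,
        List.head?_cons] at hx hy
      subst hx hy
      rw [k]
      exact h.col₁.symm
    · rw [← k] at k0
      obtain ⟨k1, k2, k3, k4⟩ := h.lift hw3 hd hnew hn3 hcf3 k0 kn
      exact hgood _ k1 k2 k4 k3 _ rfl rfl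
    · exact (hnew g₃.src (by simp)).1 k

/-- The expansion has no cusp-free cycle if no cusp-free path between `c₁` and `c₂` uses `a` at `c₁`
or `b` at `c₂`. -/
theorem cuspAcyclic (h : IsExpansion J J' col col' c t p e f a b a' b' c₁ c₂)
    (hac : CuspAcyclic J col)
    (hgood : ∀ l, IsWalk J c₁ l c₂ → (srcs l).Nodup → c₂ ∉ srcs l → CuspFree col l →
      (∀ d ∈ l.head?, d.edge ≠ a) ∧ ∀ d ∈ l.getLast?, d.edge ≠ b) :
    CuspAcyclic J' col' := by
  have hgood' : ∀ l, IsWalk J c₂ l c₁ → (srcs l).Nodup → c₁ ∉ srcs l → CuspFree col l →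
      ∀ d ∈ l.head?, d.edge ≠ b := by
    intro l hl hn hc hcf d hd
    have hrn := hl.perm.nodup_iff.1 (List.nodup_cons.2 ⟨hc, hn⟩)
    rw [List.nodup_cons] at hrn
    have := (hgood (revWalk l) (hl.revWalk h.symm) hrn.2 hrn.1 hcf.revWalk).2 d.rev (by
      rw [getLast?_revWalk]
      exact Option.mem_map_of_mem rev hd)
    exact this
  intro v l hw hn hl hcf hnc
  have hstart : ∀ d r, IsWalk J' t (d :: r) t → (srcs (d :: r)).Nodup → CuspFree col' (d :: r) →
      NoCusp col' (d :: r) (d :: r) → d.edge = e := by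
    intro d r hw hn hcf hnc
    have hdJ := hw.2.1
    rw [hw.1] at hdJ
    rcases h.t_adj _ _ hdJ with ⟨k, -⟩ | ⟨k, -⟩ | ⟨k, -⟩
    · exact (h.not_cycle_through_a hac (fun l k1 k2 k3 k4 => (hgood l k1 k2 k3 k4).1) hw hn hcf hnc
        k).elim
    · exact (h.swap.not_cycle_through_a hac hgood' hw hn hcf hnc k).elim
    · exact k
  by_cases ht : t ∈ srcs l
  · obtain ⟨l', hw, hn, hl, hcf, hnc, -⟩ := exists_rotate hw hn hcf hnc ht
    -- The reversed cycle must also leave `t` along `e`, so the cycle enters and leaves `t` by the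
    -- same edge, which is a cusp.
    rcases hrl : revWalk l' with _ | ⟨g, r'⟩
    · exact hl (revWalk_eq_nil.1 hrl)
    have h2 := hstart g r' (hrl ▸ hw.revWalk h.symm')
      (hrl ▸ ((List.perm_cons t).1 hw.perm).nodup_iff.1 hn) (hrl ▸ hcf.revWalk) (hrl ▸ hnc.revWalk)
    rcases l' with _ | ⟨d, r⟩
    · exact hl rfl
    have h1 := hstart d r hw hn hcf hnc
    have hg : (d :: r).getLast?.map rev = some g := by rw [← head?_revWalk, hrl]; rfl
    obtain ⟨z, hz, rfl⟩ := Option.map_eq_some_iff.1 hg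
    refine hnc z hz d rfl ?_
    rw [hw.getLast_tgt z hz, hw.1, h1]
    exact congrArg _ h2
  -- Away from `t` a cusp-free cycle cannot use `e`, hence misses `c`, hence also `p`, and lies in
  -- the old graph.
  · have hc : c ∉ srcs l := by
      intro hcm
      obtain ⟨x, hx, y, hy, hxc, hyc, hxy⟩ := exists_darts_at hw hn hcf hnc hcm
      have hxJ := h.symm' _ _ _ (hw.joins x hx)
      have hyJ := hw.joins y hy
      rw [hxc] at hxJ
      rw [hyc] at hyJ
      rcases h.c_adj _ _ hxJ with ⟨k1, k2⟩ | ⟨k1, k2⟩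
      · exact ht (mem_srcs.2 ⟨x, hx, k2⟩)
      · rcases h.c_adj _ _ hyJ with ⟨k3, k4⟩ | ⟨k3, k4⟩
        · exact ht (k4 ▸ hw.closed_tgt_mem hy)
        · exact hxy (by rw [k1, k3])
    have hp : p ∉ srcs l := by
      intro hpm
      obtain ⟨x, hx, y, hy, hxp, hyp, hxy⟩ := exists_darts_at hw hn hcf hnc hpm
      exact h.not_two_at_p hw hx hy hxp hyp hxy hc
    have hnew : ∀ x ∈ srcs l, x ≠ c ∧ x ≠ t ∧ x ≠ p := fun x hx =>
      ⟨fun hh => hc (hh ▸ hx), fun hh => ht (hh ▸ hx), fun hh => hp (hh ▸ hx)⟩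
    have hcc : ∀ d ∈ l, ∀ d' ∈ l, d.tgt = d'.src → col d.tgt d.edge = col d'.src d'.edge →
        col' d.tgt d.edge = col' d'.src d'.edge := by
      intro d hd d' hd' he hh
      rw [he] at hh ⊢
      obtain ⟨k1, k2, k3⟩ := hnew d'.src (mem_srcs.2 ⟨d', hd', rfl⟩)
      exact h.col_old _ _ k1 k2 k3 _ hh
    refine hac v l (hw.mono fun d hd hJ => ?_) hn hl (hcf.congr hw hcc) ?_
    · obtain ⟨k1, k2, k3⟩ := hnew d.src (mem_srcs.2 ⟨d, hd, rfl⟩)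
      obtain ⟨k4, k5, k6⟩ := hnew d.tgt (hw.closed_tgt_mem hd)
      exact (h.old _ _ _ hJ k1 k2 k3 k4 k5 k6).1
    · intro d hd d' hd' hh
      refine hnc d hd d' hd' (hcc d (List.mem_of_getLast? hd) d' (List.mem_of_mem_head? hd') ?_ hh)
      rw [hw.getLast_tgt d hd, hw.head_src d' hd']

end IsExpansion

end EdgeDart

/-! ### Correctness of nets as absence of cusp-free cycles -/

namespace EdgeDart

variable {V E C : Type*} {J : E → V → V → Prop}

theorem isWalk_of_isChain {d : EdgeDart V E} {l : List (EdgeDart V E)}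
    (hc : (d :: l).IsChain fun d d' => d.tgt = d'.src) (hJ : ∀ d' ∈ d :: l, J d'.edge d'.src d'.tgt) :
    IsWalk J d.src (d :: l) ((d :: l).getLast (by simp)).tgt := by
  induction l generalizing d with
  | nil => exact ⟨rfl, hJ d (by simp), rfl⟩
  | cons d' l ih =>
    obtain ⟨h1, h2⟩ := List.isChain_cons_cons.1 hc
    refine ⟨rfl, hJ d (by simp), ?_⟩
    rw [h1, List.getLast_cons (by simp)]
    exact ih h2 fun a ha => hJ a (List.mem_cons_of_mem _ ha)

theorem IsWalk.isChain {u w : V} {l : List (EdgeDart V E)} (h : IsWalk J u l w) :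
    l.IsChain fun d d' => d.tgt = d'.src := by
  induction l generalizing u with
  | nil => simp
  | cons d l ih =>
    rcases l with _ | ⟨d', l⟩
    · simp
    · exact List.isChain_cons_cons.2 ⟨h.2.2.1.symm, ih h.2.2⟩

/-- A relation between cyclically consecutive elements of a list. -/
theorem cyclic_of_isChain {A : Type*} {P : A → A → Prop} {d : A} {l : List A}
    (hc : (d :: l).IsChain P) (hl : P ((d :: l).getLast (by simp)) d) (i : Fin (l.length + 1)) :
    P ((d :: l).get i) ((d :: l).get (i + 1)) := by
  by_cases hi : i = Fin.last _
  · subst hi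
    rw [Fin.last_add_one]
    rw [List.getLast_eq_getElem] at hl
    exact hl
  · have hlt := Fin.lt_last_iff_ne_last.2 hi
    have hv := Fin.val_add_one_of_lt hlt
    have := List.isChain_iff_getElem.1 hc i.1 (by
      have : i.1 < l.length := hlt
      simpa using this)
    simpa [List.get_eq_getElem, hv] using this

end EdgeDart

namespace NetGraph

variable {α ν ε : Type*} {N : NetGraph α ν ε}

theorem joins_symm (x : ε) (v w : ν) (h : N.Joins x v w) : N.Joins x w v :=
  ⟨h.2.1, h.1, h.2.2.symm⟩

open Classical in
/-- The colour of an edge at a node: the premises of a `par`-node or of a contraction-node share a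
colour, all other edges have a colour of their own. -/
noncomputable def portColor (N : NetGraph α ν ε) (v : ν) (x : ε) : Option ε :=
  if (N.label v = .par ∨ N.label v = .contr) ∧ x ∈ N.prems v then none else some x

theorem portColor_eq_iff {v : ν} {x y : ε} : N.portColor v x = N.portColor v y ↔
    x = y ∨ ((N.label v = .par ∨ N.label v = .contr) ∧ x ∈ N.prems v ∧ y ∈ N.prems v) := by
  unfold portColor
  by_cases hl : N.label v = .par ∨ N.label v = .contr <;> by_cases hx : x ∈ N.prems v <;>
    by_cases hy : y ∈ N.prems v <;> simp [hl, hx, hy]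
  · rintro rfl; exact hy hx
  · rintro rfl; exact hx hy

theorem IsTyped.endpoints_eq (ht : N.IsTyped) {x : ε} {v w v' w' : ν} (h : N.Joins x v w)
    (h' : N.Joins x v' w') : (v = v' ∧ w = w') ∨ (v = w' ∧ w = v') := by
  obtain ⟨hv, hw, h⟩ := h
  obtain ⟨hv', hw', h'⟩ := h'
  rcases h with h | h <;> rcases h' with h' | h'
  · exact .inl ⟨ht.concls_unique _ hv _ hv' _ h.1 h'.1, ht.prems_unique _ hw _ hw' _ h.2 h'.2⟩
  · exact .inr ⟨ht.concls_unique _ hv _ hw' _ h.1 h'.1, ht.prems_unique _ hw _ hv' _ h.2 h'.2⟩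
  · exact .inr ⟨ht.prems_unique _ hv _ hw' _ h.2 h'.2, ht.concls_unique _ hw _ hv' _ h.1 h'.1⟩
  · exact .inl ⟨ht.prems_unique _ hv _ hv' _ h.2 h'.2, ht.concls_unique _ hw _ hw' _ h.1 h'.1⟩

theorem IsTyped.prem_node_eq (ht : N.IsTyped) {x : ε} {u v w : ν} (h : N.Joins x v w)
    (hu : u ∈ N.nodes) (hx : x ∈ N.prems u) : u = v ∨ u = w := by
  obtain ⟨hv, hw, h | h⟩ := h
  · exact .inr (ht.prems_unique _ hu _ hw _ hx h.2)
  · exact .inl (ht.prems_unique _ hu _ hv _ hx h.2)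

/-- A correct typed graph has no cusp-free cycle. -/
theorem IsCorrect.cuspAcyclic (hc : N.IsCorrect) (ht : N.IsTyped) :
    EdgeDart.CuspAcyclic N.Joins N.portColor := by
  intro u l hw hn hl hcf hnc
  rcases l with _ | ⟨d, l⟩
  · exact hl rfl
  set g := (d :: l).get with hg
  have hgl : ((d :: l).getLast?) = some ((d :: l).getLast (by simp)) :=
    List.getLast?_eq_some_getLast _
  have htgt : ∀ i : Fin (l.length + 1), (g i).tgt = (g (i + 1)).src :=
    EdgeDart.cyclic_of_isChain hw.isChain (by rw [hw.getLast_tgt _ hgl, hw.1])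
  have hcol : ∀ i : Fin (l.length + 1), N.portColor (g i).tgt (g i).edge ≠
      N.portColor (g (i + 1)).src (g (i + 1)).edge :=
    EdgeDart.cyclic_of_isChain (P := fun d d' : EdgeDart ν ε =>
      N.portColor d.tgt d.edge ≠ N.portColor d'.src d'.edge) hcf (hnc _ hgl d rfl)
  have hinj : Function.Injective fun i : Fin (l.length + 1) => (g i).src := by
    intro i j hij
    have := (List.nodup_map_iff_inj_on (List.Nodup.of_map _ hn)).1 hn _ (List.get_mem (d :: l) i) _
      (List.get_mem (d :: l) j) hij
    exact (List.nodup_iff_injective_get.1 (List.Nodup.of_map _ hn)) this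
  have hjoin : ∀ i : Fin (l.length + 1), N.Joins (g i).edge (g i).src (g (i + 1)).src := by
    intro i
    rw [← htgt]
    exact hw.joins _ (List.get_mem (d :: l) i)
  have hcol' : ∀ i j : Fin (l.length + 1), i = j + 1 → N.portColor (g i).src (g i).edge ≠
      N.portColor (g i).src (g j).edge := by
    rintro i j rfl
    have := hcol j
    rw [htgt] at this
    exact this.symm
  -- An edge used twice in the same direction repeats a vertex; used in both directions, it is
  -- consecutive with itself, which is a cusp.
  have hedge : Function.Injective fun i : Fin (l.length + 1) => (g i).edge := by
    intro i j hij
    have h2 := hjoin j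
    rw [show (g j).edge = (g i).edge from hij.symm] at h2
    rcases ht.endpoints_eq (hjoin i) h2 with ⟨h, -⟩ | ⟨h, -⟩
    · exact hinj h
    · refine (hcol' i j (hinj h) ?_).elim
      exact congrArg _ hij
  obtain ⟨w, hwN, hlab, i, j, hij, hi, hj⟩ := hc l.length (fun i => (g i).src) (fun i => (g i).edge)
    ⟨hinj, hedge, hjoin⟩
  have hi' := ht.prem_node_eq (hjoin i) hwN hi
  have hj' := ht.prem_node_eq (hjoin j) hwN hj
  -- One premise leaves `w` and the other enters it; as the nodes are distinct, they are consecutive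
  -- at `w`, where they have the same colour.
  have key : ∀ i j : Fin (l.length + 1), (g i).edge ∈ N.prems w → (g j).edge ∈ N.prems w →
      w = (g i).src → w = (g (j + 1)).src → False := by
    intro i j hi hj h1 h2
    refine hcol' i j (hinj (h1.symm.trans h2)) ?_
    rw [← h1]
    exact portColor_eq_iff.2 (.inr ⟨hlab, hi, hj⟩)
  rcases hi' with h1 | h1 <;> rcases hj' with h2 | h2
  · exact hij (hinj (h1.symm.trans h2))
  · exact key i j hi hj h1 h2
  · exact key j i hj hi h2 h1
  · exact hij (add_right_cancel (hinj (h1.symm.trans h2)))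

/-- A graph without loops and without cusp-free cycle is correct. -/
theorem isCorrect_of_cuspAcyclic (hloop : ∀ x v, ¬ N.Joins x v v)
    (hac : EdgeDart.CuspAcyclic N.Joins N.portColor) : N.IsCorrect := by
  intro k v x hcyc
  by_contra! hno
  -- This excludes `k = 0`, where the single edge would be its own successor: a loop has a cusp in
  -- the coloured sense but violates correctness.
  have hne : ∀ i : Fin (k + 1), i ≠ i + 1 := fun i h => hloop (x i) (v i) (by
    have := hcyc.joins i
    rwa [← h] at this)
  let g : Fin (k + 1) → EdgeDart ν ε := fun i => ⟨v i, x i, v (i + 1)⟩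
  have hcol : ∀ i, N.portColor (g i).tgt (g i).edge ≠ N.portColor (g (i + 1)).src (g (i + 1)).edge := by
    intro i h
    rcases portColor_eq_iff.1 h with h | ⟨h1, h2, h3⟩
    · exact hne i (hcyc.edges_injective h)
    · exact hno (v (i + 1)) (hcyc.joins i).2.1 h1 i (i + 1) (hne i) h2 h3
  have hl : List.ofFn g = g 0 :: List.ofFn fun i : Fin k => g i.succ := List.ofFn_succ
  have hchain : ∀ P : EdgeDart ν ε → EdgeDart ν ε → Prop, (∀ i, P (g i) (g (i + 1))) →
      (List.ofFn g).IsChain P := by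
    intro P hP
    refine List.isChain_iff_getElem.2 fun i hi => ?_
    rw [List.length_ofFn] at hi
    have := hP ⟨i, by omega⟩
    have e : (⟨i, by omega⟩ + 1 : Fin (k + 1)) = ⟨i + 1, hi⟩ := by
      ext
      exact Fin.val_add_one_of_lt (i := ⟨i, by omega⟩) (by rw [Fin.lt_def]; simp; omega)
    rw [e] at this
    rwa [List.getElem_ofFn, List.getElem_ofFn]
  have hlast : (List.ofFn g).getLast? = some (g (Fin.last k)) := by
    rw [List.getLast?_eq_getElem?, List.length_ofFn, List.getElem?_ofFn]
    simp [Fin.last]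
  have hw : EdgeDart.IsWalk N.Joins (v 0) (List.ofFn g) (v 0) := by
    have h1 := hchain (fun d d' => d.tgt = d'.src) fun i => rfl
    have h2 : ∀ d ∈ List.ofFn g, N.Joins d.edge d.src d.tgt := by
      intro d hd
      obtain ⟨i, rfl⟩ := (List.mem_ofFn' _ _).1 hd
      exact hcyc.joins i
    rw [hl] at h1 h2
    have h3 := EdgeDart.isWalk_of_isChain h1 h2
    have h4 : (g 0 :: List.ofFn fun i : Fin k => g i.succ).getLast (by simp) = g (Fin.last k) := by
      have := hlast
      rw [hl, List.getLast?_eq_some_getLast (by simp)] at this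
      exact Option.some.inj this
    rw [h4] at h3
    rw [hl]
    simpa [g] using h3
  refine hac (v 0) (List.ofFn g) hw ?_ (by rw [hl]; simp) (hchain _ hcol) ?_
  · rw [EdgeDart.srcs, List.map_ofFn]
    exact List.nodup_ofFn.2 hcyc.nodes_injective
  · intro d hd d' hd'
    rw [hlast] at hd
    rw [hl] at hd'
    simp only [Option.mem_def, Option.some.injEq, List.head?_cons] at hd hd'
    subst hd hd'
    have := hcol (Fin.last k)
    rwa [Fin.last_add_one] at this

theorem IsCorrect.not_loop (hc : N.IsCorrect) (x : ε) (v : ν) : ¬ N.Joins x v v := by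
  intro h
  have : Subsingleton (Fin (0 + 1)) := inferInstanceAs (Subsingleton (Fin 1))
  obtain ⟨w, -, -, i, j, hij, -⟩ := hc 0 (fun _ => v) (fun _ => x)
    ⟨Function.injective_of_subsingleton _, Function.injective_of_subsingleton _, fun _ => h⟩
  exact hij (Subsingleton.elim i j)

/-- A subgraph of a correct typed graph is correct. -/
theorem IsCorrect.restrict (hc : N.IsCorrect) (ht : N.IsTyped) {W : Finset ν} (F : Finset ε)
    (hW : W ⊆ N.nodes) : (N.restrict W F).IsCorrect := by
  intro k v x hcyc
  have hj : ∀ i, N.Joins (x i) (v i) (v (i + 1)) := fun i =>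
    ⟨hW (hcyc.joins i).1, hW (hcyc.joins i).2.1, (hcyc.joins i).2.2⟩
  obtain ⟨w, hw, hl, i, j, hij, hi, hj'⟩ := hc k v x ⟨hcyc.nodes_injective, hcyc.edges_injective, hj⟩
  refine ⟨w, ?_, hl, i, j, hij, hi, hj'⟩
  -- The node provided by the correctness of `N` is an endpoint of an edge of the cycle, hence
  -- belongs to the subgraph.
  rcases ht.prem_node_eq (hj i) hw hi with rfl | rfl
  · exact (hcyc.joins i).1
  · exact (hcyc.joins i).2.1

end NetGraph

/-! ### Expansion of a net -/

theorem MLLFormula.dual_dual {α : Type*} (A : MLLFormula α) : A.dual.dual = A := by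
  induction A <;> simp_all [MLLFormula.dual]

theorem NodeLabel.Typing.cut_inv {α : Type*} {Γ Δ : List (MLLFormula α)}
    (h : NodeLabel.Typing .cut Γ Δ) : ∃ A, Γ = [A, A.dual] ∧ Δ = [] := by
  cases h with
  | cut A => exact ⟨A, rfl, rfl⟩

namespace NetGraph

variable {α ν ε : Type*} {N : NetGraph α ν ε}

theorem IsTyped.cut_concls (ht : N.IsTyped) {c : ν} (hc : c ∈ N.nodes) (hl : N.label c = .cut) :
    N.concls c = [] := by
  have := ht.typing c hc
  rw [hl] at this
  obtain ⟨A, -, h⟩ := this.cut_inv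
  simpa using h

theorem IsTyped.cut_dual (ht : N.IsTyped) {c : ν} (hc : c ∈ N.nodes) (hl : N.label c = .cut)
    {a a' : ε} (hp : (N.prems c).Perm [a, a']) : N.type a' = (N.type a).dual := by
  have := ht.typing c hc
  rw [hl] at this
  obtain ⟨A, h, -⟩ := this.cut_inv
  have hp' := hp.map N.type
  rw [h] at hp'
  rcases List.perm_pair.1 hp' with h' | h'
  · simp at h'
    rw [← h'.1, ← h'.2]
  · simp at h'
    rw [← h'.1, ← h'.2, MLLFormula.dual_dual]

open Classical in
/-- The `⊗/⅋`-expansion of the cuts `c₁`, between `a` and `a'`, and `c₂`, between `b` and `b'`, with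
new nodes `c, t, p` and new edges `e, f`. -/
noncomputable def expand (N : NetGraph α ν ε) (c t p : ν) (e f a b a' b' : ε) (c₁ c₂ : ν) :
    NetGraph α ν ε where
  nodes := insert c (insert t (insert p ((N.nodes.erase c₁).erase c₂)))
  edges := insert e (insert f N.edges)
  label v := if v = c then .cut else if v = t then .tensor else if v = p then .par else N.label v
  prems v := if v = c then [e, f] else if v = t then [a, b] else if v = p then [a', b']
    else N.prems v
  concls v := if v = c then [] else if v = t then [e] else if v = p then [f] else N.concls v
  type x := if x = e then .tensor (N.type a) (N.type b)
    else if x = f then .par (N.type a') (N.type b') else N.type x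

/-- Two cuts of a proof-net, and fresh names, to which an expansion can be applied. -/
structure IsExpandable (N : NetGraph α ν ε) (c t p : ν) (e f a b a' b' : ε) (c₁ c₂ : ν) : Prop where
  isProofNet : N.IsProofNet
  c_fresh : c ∉ N.nodes
  t_fresh : t ∉ N.nodes
  p_fresh : p ∉ N.nodes
  c_ne_t : c ≠ t
  c_ne_p : c ≠ p
  t_ne_p : t ≠ p
  e_fresh : e ∉ N.edges
  f_fresh : f ∉ N.edges
  e_ne_f : e ≠ f
  c₁_mem : c₁ ∈ N.nodes
  c₂_mem : c₂ ∈ N.nodes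
  c₁_ne_c₂ : c₁ ≠ c₂
  c₁_label : N.label c₁ = .cut
  c₂_label : N.label c₂ = .cut
  c₁_prems : (N.prems c₁).Perm [a, a']
  c₂_prems : (N.prems c₂).Perm [b, b']

namespace IsExpandable

variable {c t p : ν} {e f a b a' b' : ε} {c₁ c₂ : ν}

theorem mem_c₁_prems (h : N.IsExpandable c t p e f a b a' b' c₁ c₂) {x : ε} :
    x ∈ N.prems c₁ ↔ x = a ∨ x = a' := by
  rw [h.c₁_prems.mem_iff]; simp

theorem mem_c₂_prems (h : N.IsExpandable c t p e f a b a' b' c₁ c₂) {x : ε} :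
    x ∈ N.prems c₂ ↔ x = b ∨ x = b' := by
  rw [h.c₂_prems.mem_iff]; simp

theorem a_ne_a' (h : N.IsExpandable c t p e f a b a' b' c₁ c₂) : a ≠ a' := by
  have := h.c₁_prems.nodup_iff.1 (h.isProofNet.typed.prems_nodup _ h.c₁_mem)
  simpa using this

theorem b_ne_b' (h : N.IsExpandable c t p e f a b a' b' c₁ c₂) : b ≠ b' := by
  have := h.c₂_prems.nodup_iff.1 (h.isProofNet.typed.prems_nodup _ h.c₂_mem)
  simpa using this

theorem prems_ne (h : N.IsExpandable c t p e f a b a' b' c₁ c₂) :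
    a ≠ b ∧ a ≠ b' ∧ a' ≠ b ∧ a' ≠ b' := by
  have key : ∀ x, x ∈ N.prems c₁ → x ∉ N.prems c₂ := fun x h1 h2 =>
    h.c₁_ne_c₂ (h.isProofNet.typed.prems_unique _ h.c₁_mem _ h.c₂_mem x h1 h2)
  have ha := key a (h.mem_c₁_prems.2 (.inl rfl))
  have ha' := key a' (h.mem_c₁_prems.2 (.inr rfl))
  rw [h.mem_c₂_prems, not_or] at ha ha'
  exact ⟨ha.1, ha.2, ha'.1, ha'.2⟩

theorem prems_mem (h : N.IsExpandable c t p e f a b a' b' c₁ c₂) :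
    a ∈ N.edges ∧ b ∈ N.edges ∧ a' ∈ N.edges ∧ b' ∈ N.edges := by
  have h1 := h.isProofNet.typed.prems_mem _ h.c₁_mem
  have h2 := h.isProofNet.typed.prems_mem _ h.c₂_mem
  simp only [h.mem_c₁_prems, h.mem_c₂_prems] at h1 h2
  exact ⟨h1 a (.inl rfl), h2 b (.inl rfl), h1 a' (.inr rfl), h2 b' (.inr rfl)⟩

theorem mem_nodes (_h : N.IsExpandable c t p e f a b a' b' c₁ c₂) {v : ν} :
    v ∈ (N.expand c t p e f a b a' b' c₁ c₂).nodes ↔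
      v = c ∨ v = t ∨ v = p ∨ (v ∈ N.nodes ∧ v ≠ c₁ ∧ v ≠ c₂) := by
  simp only [expand, Finset.mem_insert, Finset.mem_erase]
  tauto

theorem mem_edges {x : ε} :
    x ∈ (N.expand c t p e f a b a' b' c₁ c₂).edges ↔ x = e ∨ x = f ∨ x ∈ N.edges := by
  simp [expand]

theorem at_c : (N.expand c t p e f a b a' b' c₁ c₂).label c = .cut ∧
    (N.expand c t p e f a b a' b' c₁ c₂).prems c = [e, f] ∧
    (N.expand c t p e f a b a' b' c₁ c₂).concls c = [] := by
  simp [expand]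

theorem at_t (h : N.IsExpandable c t p e f a b a' b' c₁ c₂) :
    (N.expand c t p e f a b a' b' c₁ c₂).label t = .tensor ∧
    (N.expand c t p e f a b a' b' c₁ c₂).prems t = [a, b] ∧
    (N.expand c t p e f a b a' b' c₁ c₂).concls t = [e] := by
  simp [expand, h.c_ne_t.symm]

theorem at_p (h : N.IsExpandable c t p e f a b a' b' c₁ c₂) :
    (N.expand c t p e f a b a' b' c₁ c₂).label p = .par ∧
    (N.expand c t p e f a b a' b' c₁ c₂).prems p = [a', b'] ∧
    (N.expand c t p e f a b a' b' c₁ c₂).concls p = [f] := by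
  simp [expand, h.c_ne_p.symm, h.t_ne_p.symm]

theorem at_old {v : ν} (hc : v ≠ c) (ht : v ≠ t) (hp : v ≠ p) :
    (N.expand c t p e f a b a' b' c₁ c₂).label v = N.label v ∧
    (N.expand c t p e f a b a' b' c₁ c₂).prems v = N.prems v ∧
    (N.expand c t p e f a b a' b' c₁ c₂).concls v = N.concls v := by
  simp [expand, hc, ht, hp]

theorem ne_of_mem (h : N.IsExpandable c t p e f a b a' b' c₁ c₂) {v : ν} (hv : v ∈ N.nodes) :
    v ≠ c ∧ v ≠ t ∧ v ≠ p :=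
  ⟨fun hh => h.c_fresh (hh ▸ hv), fun hh => h.t_fresh (hh ▸ hv), fun hh => h.p_fresh (hh ▸ hv)⟩

theorem type_old (h : N.IsExpandable c t p e f a b a' b' c₁ c₂) {x : ε} (hx : x ∈ N.edges) :
    (N.expand c t p e f a b a' b' c₁ c₂).type x = N.type x := by
  have h1 : x ≠ e := fun hh => h.e_fresh (hh ▸ hx)
  have h2 : x ≠ f := fun hh => h.f_fresh (hh ▸ hx)
  simp [expand, h1, h2]

/-- An old node which remains has none of `a, b, a', b'` as a premise, because these are already
premises of the removed cuts. -/
theorem prem_cases (h : N.IsExpandable c t p e f a b a' b' c₁ c₂) {v : ν} {x : ε}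
    (hv : v ∈ (N.expand c t p e f a b a' b' c₁ c₂).nodes)
    (hx : x ∈ (N.expand c t p e f a b a' b' c₁ c₂).prems v) :
    (v = c ∧ (x = e ∨ x = f)) ∨ (v = t ∧ (x = a ∨ x = b)) ∨ (v = p ∧ (x = a' ∨ x = b')) ∨
      (v ∈ N.nodes ∧ x ∈ N.prems v ∧ x ∈ N.edges ∧ x ≠ a ∧ x ≠ b ∧ x ≠ a' ∧ x ≠ b') := by
  have hN := h.isProofNet.typed
  rcases h.mem_nodes.1 hv with rfl | rfl | rfl | ⟨hv, hv1, hv2⟩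
  · rw [at_c.2.1] at hx
    exact .inl ⟨rfl, by simpa using hx⟩
  · rw [h.at_t.2.1] at hx
    exact .inr (.inl ⟨rfl, by simpa using hx⟩)
  · rw [h.at_p.2.1] at hx
    exact .inr (.inr (.inl ⟨rfl, by simpa using hx⟩))
  · obtain ⟨k1, k2, k3⟩ := h.ne_of_mem hv
    rw [(at_old k1 k2 k3).2.1] at hx
    have hx1 : x ∉ N.prems c₁ := fun hh => hv1 (hN.prems_unique _ hv _ h.c₁_mem x hx hh)
    have hx2 : x ∉ N.prems c₂ := fun hh => hv2 (hN.prems_unique _ hv _ h.c₂_mem x hx hh)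
    rw [h.mem_c₁_prems, not_or] at hx1
    rw [h.mem_c₂_prems, not_or] at hx2
    exact .inr (.inr (.inr ⟨hv, hx, hN.prems_mem v hv x hx, hx1.1, hx2.1, hx1.2, hx2.2⟩))

theorem concl_cases (h : N.IsExpandable c t p e f a b a' b' c₁ c₂) {v : ν} {x : ε}
    (hv : v ∈ (N.expand c t p e f a b a' b' c₁ c₂).nodes)
    (hx : x ∈ (N.expand c t p e f a b a' b' c₁ c₂).concls v) :
    (v = t ∧ x = e) ∨ (v = p ∧ x = f) ∨ (v ∈ N.nodes ∧ x ∈ N.concls v ∧ x ∈ N.edges) := by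
  rcases h.mem_nodes.1 hv with rfl | rfl | rfl | ⟨hv, hv1, hv2⟩
  · simp [at_c.2.2] at hx
  · rw [h.at_t.2.2] at hx
    exact .inl ⟨rfl, by simpa using hx⟩
  · rw [h.at_p.2.2] at hx
    exact .inr (.inl ⟨rfl, by simpa using hx⟩)
  · obtain ⟨k1, k2, k3⟩ := h.ne_of_mem hv
    rw [(at_old k1 k2 k3).2.2] at hx
    exact .inr (.inr ⟨hv, hx, h.isProofNet.typed.concls_mem v hv x hx⟩)

theorem expand_prems_unique (h : N.IsExpandable c t p e f a b a' b' c₁ c₂) {v w : ν} {x : ε}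
    (hv : v ∈ (N.expand c t p e f a b a' b' c₁ c₂).nodes)
    (hw : w ∈ (N.expand c t p e f a b a' b' c₁ c₂).nodes)
    (hx : x ∈ (N.expand c t p e f a b a' b' c₁ c₂).prems v)
    (hx' : x ∈ (N.expand c t p e f a b a' b' c₁ c₂).prems w) : v = w := by
  have hf1 := h.e_fresh
  have hf2 := h.f_fresh
  obtain ⟨hma, hmb, hma', hmb'⟩ := h.prems_mem
  obtain ⟨n1, n2, n3, n4⟩ := h.prems_ne
  have n5 := h.a_ne_a'
  have n6 := h.b_ne_b'
  have hu := h.isProofNet.typed.prems_unique v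
  have h1 := h.prem_cases hv hx
  have h2 := h.prem_cases hw hx'
  clear hx hx' hv hw h
  rcases h1 with ⟨rfl, h1⟩ | ⟨rfl, h1⟩ | ⟨rfl, h1⟩ | ⟨k1, k2, k3, k4⟩ <;>
    rcases h2 with ⟨rfl, h2⟩ | ⟨rfl, h2⟩ | ⟨rfl, h2⟩ | ⟨l1, l2, l3, l4⟩
  case inr.inr.inr.inr.inr.inr => exact hu k1 w l1 x k2 l2
  all_goals clear hu; grind

theorem expand_concls_unique (h : N.IsExpandable c t p e f a b a' b' c₁ c₂) {v w : ν} {x : ε}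
    (hv : v ∈ (N.expand c t p e f a b a' b' c₁ c₂).nodes)
    (hw : w ∈ (N.expand c t p e f a b a' b' c₁ c₂).nodes)
    (hx : x ∈ (N.expand c t p e f a b a' b' c₁ c₂).concls v)
    (hx' : x ∈ (N.expand c t p e f a b a' b' c₁ c₂).concls w) : v = w := by
  have hf1 := h.e_fresh
  have hf2 := h.f_fresh
  have hef := h.e_ne_f
  have hu := h.isProofNet.typed.concls_unique v
  have h1 := h.concl_cases hv hx
  have h2 := h.concl_cases hw hx'
  clear hx hx' hv hw h
  rcases h1 with ⟨rfl, h1⟩ | ⟨rfl, h1⟩ | ⟨k1, k2, k3⟩ <;>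
    rcases h2 with ⟨rfl, h2⟩ | ⟨rfl, h2⟩ | ⟨l1, l2, l3⟩
  case inr.inr.inr.inr => exact hu k1 w l1 x k2 l2
  all_goals clear hu; grind

theorem isTyped (h : N.IsExpandable c t p e f a b a' b' c₁ c₂) :
    (N.expand c t p e f a b a' b' c₁ c₂).IsTyped := by
  have hN := h.isProofNet.typed
  obtain ⟨hc1, hc2, hc3⟩ := at_c (N := N) (c := c) (t := t) (p := p) (e := e) (f := f) (a := a)
    (b := b) (a' := a') (b' := b') (c₁ := c₁) (c₂ := c₂)
  obtain ⟨ht1, ht2, ht3⟩ := h.at_t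
  obtain ⟨hp1, hp2, hp3⟩ := h.at_p
  have hold : ∀ v ∈ N.nodes, _ := fun v hv => at_old (N := N) (e := e) (f := f) (a := a)
    (b := b) (a' := a') (b' := b') (c₁ := c₁) (c₂ := c₂) (h.ne_of_mem hv).1 (h.ne_of_mem hv).2.1
    (h.ne_of_mem hv).2.2
  have hmn := fun v => h.mem_nodes (v := v)
  have hme := fun x => mem_edges (N := N) (c := c) (t := t) (p := p) (e := e) (f := f) (a := a)
    (b := b) (a' := a') (b' := b') (c₁ := c₁) (c₂ := c₂) (x := x)
  obtain ⟨hma, hmb, hma', hmb'⟩ := h.prems_mem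
  obtain ⟨n1, n2, n3, n4⟩ := h.prems_ne
  have hto := fun x => h.type_old (x := x)
  have hte : (N.expand c t p e f a b a' b' c₁ c₂).type e = .tensor (N.type a) (N.type b) := by
    simp [expand]
  have htf : (N.expand c t p e f a b a' b' c₁ c₂).type f = .par (N.type a') (N.type b') := by
    simp [expand, h.e_ne_f.symm]
  have hda := hN.cut_dual h.c₁_mem h.c₁_label h.c₁_prems
  have hdb := hN.cut_dual h.c₂_mem h.c₂_label h.c₂_prems
  have hef := h.e_ne_f
  have hP := hN.prems_mem
  have hC := hN.concls_mem
  have hPu := fun v hv w hw x => h.expand_prems_unique (v := v) (w := w) (x := x) hv hw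
  have hCu := fun v hv w hw x => h.expand_concls_unique (v := v) (w := w) (x := x) hv hw
  generalize hM : N.expand c t p e f a b a' b' c₁ c₂ = M at *
  constructor
  · intro v hv x hx
    rcases (hmn v).1 hv with rfl | rfl | rfl | ⟨hv, -, -⟩
    · rw [hc2] at hx
      exact (hme x).2 (by simp at hx; tauto)
    · rw [ht2] at hx
      exact (hme x).2 (.inr (.inr (by simp at hx; rcases hx with rfl | rfl <;> assumption)))
    · rw [hp2] at hx
      exact (hme x).2 (.inr (.inr (by simp at hx; rcases hx with rfl | rfl <;> assumption)))
    · rw [(hold v hv).2.1] at hx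
      exact (hme x).2 (.inr (.inr (hP v hv x hx)))
  · intro v hv x hx
    rcases (hmn v).1 hv with rfl | rfl | rfl | ⟨hv, -, -⟩
    · simp [hc3] at hx
    · rw [ht3] at hx
      exact (hme x).2 (by simp at hx; tauto)
    · rw [hp3] at hx
      exact (hme x).2 (by simp at hx; tauto)
    · rw [(hold v hv).2.2] at hx
      exact (hme x).2 (.inr (.inr (hC v hv x hx)))
  · intro v hv
    rcases (hmn v).1 hv with rfl | rfl | rfl | ⟨hv, -, -⟩
    · rw [hc1, hc2, hc3]
      simp only [List.map_cons, List.map_nil, hte, htf, hda, hdb]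
      -- Since `a'` and `b'` have the dual types of `a` and `b`, the type of `f` is by definition
      -- the dual of that of `e`.
      exact .cut (.tensor (N.type a) (N.type b))
    · rw [ht1, ht2, ht3]
      simp only [List.map_cons, List.map_nil, hte, hto a hma, hto b hmb]
      exact .tensor _ _
    · rw [hp1, hp2, hp3]
      simp only [List.map_cons, List.map_nil, htf, hto a' hma', hto b' hmb']
      exact .par _ _
    · obtain ⟨k1, k2, k3⟩ := hold v hv
      rw [k1, k2, k3, List.map_congr_left fun x hx => hto x (hP v hv x hx),
        List.map_congr_left fun x hx => hto x (hC v hv x hx)]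
      exact hN.typing v hv
  · intro v hv
    rcases (hmn v).1 hv with rfl | rfl | rfl | ⟨hv, -, -⟩
    · simpa [hc2] using hef
    · simpa [ht2] using n1
    · simpa [hp2] using n4
    · rw [(hold v hv).2.1]
      exact hN.prems_nodup v hv
  · intro v hv
    rcases (hmn v).1 hv with rfl | rfl | rfl | ⟨hv, -, -⟩
    · simp [hc3]
    · simp [ht3]
    · simp [hp3]
    · rw [(hold v hv).2.2]
      exact hN.concls_nodup v hv
  · exact hPu
  · exact hCu

theorem tensorParStep (h : N.IsExpandable c t p e f a b a' b' c₁ c₂) :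
    (N.expand c t p e f a b a' b' c₁ c₂).TensorParStep N c t p e f a b a' b' c₁ c₂ := by
  have hN := h.isProofNet.typed
  obtain ⟨ht1, ht2, ht3⟩ := h.at_t
  obtain ⟨hp1, hp2, hp3⟩ := h.at_p
  have k1 := h.ne_of_mem h.c₁_mem
  have k2 := h.ne_of_mem h.c₂_mem
  refine ⟨h.mem_nodes.2 (by simp), h.mem_nodes.2 (by simp), h.mem_nodes.2 (by simp), at_c.1, ht1, hp1,
    by rw [at_c.2.1], ht2, ht3, hp2, hp3, ?_, ?_, h.c₁_ne_c₂, ?_, ?_, h.c₁_label, h.c₂_label,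
    h.c₁_prems, h.c₂_prems, hN.cut_concls h.c₁_mem h.c₁_label, hN.cut_concls h.c₂_mem h.c₂_label,
    ?_, ?_⟩
  · rw [h.mem_nodes]; tauto
  · rw [h.mem_nodes]; tauto
  · intro v
    rw [h.mem_nodes]
    constructor
    · intro hv
      have := h.ne_of_mem hv
      tauto
    · rintro (hv | rfl | rfl)
      · tauto
      · exact h.c₁_mem
      · exact h.c₂_mem
  · intro x
    rw [mem_edges]
    constructor
    · intro hx
      exact ⟨.inr (.inr hx), fun hh => h.e_fresh (hh ▸ hx), fun hh => h.f_fresh (hh ▸ hx)⟩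
    · tauto
  · intro v _ hc ht hp
    obtain ⟨k1, k2, k3⟩ := at_old (N := N) (e := e) (f := f) (a := a)
      (b := b) (a' := a') (b' := b') (c₁ := c₁) (c₂ := c₂) hc ht hp
    exact ⟨k1.symm, k2.symm, k3.symm⟩
  · exact fun x hx => (h.type_old hx).symm

theorem isExpansion (h : N.IsExpandable c t p e f a b a' b' c₁ c₂) :
    EdgeDart.IsExpansion N.Joins (N.expand c t p e f a b a' b' c₁ c₂).Joins N.portColor
      (N.expand c t p e f a b a' b' c₁ c₂).portColor c t p e f a b a' b' c₁ c₂ := by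
  have hN := h.isProofNet.typed
  obtain ⟨hc1, hc2, hc3⟩ := at_c (N := N) (c := c) (t := t) (p := p) (e := e) (f := f) (a := a)
    (b := b) (a' := a') (b' := b') (c₁ := c₁) (c₂ := c₂)
  obtain ⟨ht1, ht2, ht3⟩ := h.at_t
  obtain ⟨hp1, hp2, hp3⟩ := h.at_p
  obtain ⟨hma, hmb, hma', hmb'⟩ := h.prems_mem
  obtain ⟨n1, n2, n3, n4⟩ := h.prems_ne
  have hef := h.e_ne_f
  have hea : ∀ x ∈ N.edges, x ≠ e := fun x hx hh => h.e_fresh (hh ▸ hx)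
  have hfa : ∀ x ∈ N.edges, x ≠ f := fun x hx hh => h.f_fresh (hh ▸ hx)
  have hold : ∀ v ∈ N.nodes, _ := fun v hv => at_old (N := N) (e := e) (f := f) (a := a)
    (b := b) (a' := a') (b' := b') (c₁ := c₁) (c₂ := c₂) (h.ne_of_mem hv).1 (h.ne_of_mem hv).2.1
    (h.ne_of_mem hv).2.2
  have hconcl_old : ∀ x ∈ N.edges, ∀ w ∈ (N.expand c t p e f a b a' b' c₁ c₂).nodes,
      x ∈ (N.expand c t p e f a b a' b' c₁ c₂).concls w →
      w ∈ N.nodes ∧ x ∈ N.concls w ∧ w ≠ c₁ ∧ w ≠ c₂ := by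
    intro x hx w hw hxw
    rcases h.mem_nodes.1 hw with rfl | rfl | rfl | ⟨hw, hw1, hw2⟩
    · simp [hc3] at hxw
    · simp [ht3] at hxw
      exact absurd hxw (hea x hx)
    · simp [hp3] at hxw
      exact absurd hxw (hfa x hx)
    · rw [(hold w hw).2.2] at hxw
      exact ⟨hw, hxw, hw1, hw2⟩
  have hconcl_e : ∀ w ∈ (N.expand c t p e f a b a' b' c₁ c₂).nodes,
      e ∈ (N.expand c t p e f a b a' b' c₁ c₂).concls w → w = t := by
    intro w hw hxw
    exact h.isTyped.concls_unique _ hw t (h.mem_nodes.2 (by simp)) e hxw (by simp [ht3])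
  have hconcl_f : ∀ w ∈ (N.expand c t p e f a b a' b' c₁ c₂).nodes,
      f ∈ (N.expand c t p e f a b a' b' c₁ c₂).concls w → w = p := by
    intro w hw hxw
    exact h.isTyped.concls_unique _ hw p (h.mem_nodes.2 (by simp)) f hxw (by simp [hp3])
  have hprem_ef : ∀ x, x = e ∨ x = f → ∀ w ∈ (N.expand c t p e f a b a' b' c₁ c₂).nodes,
      x ∈ (N.expand c t p e f a b a' b' c₁ c₂).prems w → w = c := by
    intro x hx w hw hxw
    exact h.isTyped.prems_unique _ hw c (h.mem_nodes.2 (by simp)) x hxw (by simpa [hc2] using hx)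
  refine ⟨joins_symm, joins_symm, ?_, ?_, ?_, ?_, ?_, ?_, ?_, ?_, ?_, h.c_ne_t, (hea a hma).symm,
    (hea b hmb).symm, n1, h.c₁_ne_c₂⟩
  · rintro x w ⟨-, hw, hx | hx⟩
    · simp [hc3] at hx
    · obtain ⟨hx1, hx2⟩ := hx
      simp [hc2] at hx2
      rcases hx2 with rfl | rfl
      · exact .inl ⟨rfl, hconcl_e w hw hx1⟩
      · exact .inr ⟨rfl, hconcl_f w hw hx1⟩
  · rintro x w ⟨-, hw, hx | hx⟩
    · obtain ⟨hx1, hx2⟩ := hx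
      simp [ht3] at hx1
      exact .inr (.inr ⟨hx1, hprem_ef x (.inl hx1) w hw hx2⟩)
    · obtain ⟨hx1, hx2⟩ := hx
      simp [ht2] at hx2
      rcases hx2 with rfl | rfl
      · obtain ⟨k1, k2, k3, k4⟩ := hconcl_old x hma w hw hx1
        exact .inl ⟨rfl, ⟨h.c₁_mem, k1, .inr ⟨k2, h.mem_c₁_prems.2 (.inl rfl)⟩⟩, k3, k4⟩
      · obtain ⟨k1, k2, k3, k4⟩ := hconcl_old x hmb w hw hx1
        exact .inr (.inl ⟨rfl, ⟨h.c₂_mem, k1, .inr ⟨k2, h.mem_c₂_prems.2 (.inl rfl)⟩⟩, k3, k4⟩)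
  · rintro x w ⟨-, hw, hx | hx⟩
    · obtain ⟨hx1, hx2⟩ := hx
      simp [hp3] at hx1
      exact .inr (.inr ⟨hx1, hprem_ef x (.inr hx1) w hw hx2⟩)
    · obtain ⟨hx1, hx2⟩ := hx
      simp [hp2] at hx2
      rcases hx2 with rfl | rfl
      · obtain ⟨k1, k2, k3, k4⟩ := hconcl_old x hma' w hw hx1
        exact .inl ⟨rfl, ⟨h.c₁_mem, k1, .inr ⟨k2, h.mem_c₁_prems.2 (.inr rfl)⟩⟩, k3, k4⟩
      · obtain ⟨k1, k2, k3, k4⟩ := hconcl_old x hmb' w hw hx1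
        exact .inr (.inl ⟨rfl, ⟨h.c₂_mem, k1, .inr ⟨k2, h.mem_c₂_prems.2 (.inr rfl)⟩⟩, k3, k4⟩)
  · rintro x u w ⟨hu, hw, hx⟩ k1 k2 k3 k4 k5 k6
    obtain ⟨hu, hu1, hu2⟩ : u ∈ N.nodes ∧ u ≠ c₁ ∧ u ≠ c₂ := by
      have := h.mem_nodes.1 hu
      tauto
    obtain ⟨hw, -⟩ : w ∈ N.nodes ∧ w ≠ c₁ ∧ w ≠ c₂ := by
      have := h.mem_nodes.1 hw
      tauto
    rw [(hold u hu).2.1, (hold u hu).2.2, (hold w hw).2.1, (hold w hw).2.2] at hx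
    exact ⟨⟨hu, hw, hx⟩, hu1, hu2⟩
  · exact fun x u w hx => h.ne_of_mem hx.1
  · intro v x k1 k2 k3 y hxy
    obtain ⟨m1, m2, -⟩ := at_old (N := N) (e := e) (f := f) (a := a)
      (b := b) (a' := a') (b' := b') (c₁ := c₁) (c₂ := c₂) k1 k2 k3
    rw [portColor_eq_iff] at hxy ⊢
    rwa [m1, m2]
  · rw [portColor_eq_iff]
    exact .inr ⟨.inl hp1, by simp [hp2], by simp [hp2]⟩
  · rw [Ne, portColor_eq_iff]
    simp [h.a_ne_a', h.c₁_label]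
  · rw [Ne, portColor_eq_iff]
    simp [h.b_ne_b', h.c₂_label]

theorem not_loop (h : N.IsExpandable c t p e f a b a' b' c₁ c₂) (x : ε) (v : ν) :
    ¬ (N.expand c t p e f a b a' b' c₁ c₂).Joins x v v := by
  intro hx
  have hE := h.isExpansion
  by_cases hc : v = c
  · subst hc
    rcases hE.c_adj _ _ hx with ⟨-, k⟩ | ⟨-, k⟩
    · exact h.c_ne_t k
    · exact h.c_ne_p k
  by_cases ht : v = t
  · subst ht
    rcases hE.t_adj _ _ hx with ⟨-, k, -⟩ | ⟨-, k, -⟩ | ⟨-, k⟩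
    · exact h.t_fresh k.2.1
    · exact h.t_fresh k.2.1
    · exact hc k
  by_cases hp : v = p
  · subst hp
    rcases hE.p_adj _ _ hx with ⟨-, k, -⟩ | ⟨-, k, -⟩ | ⟨-, k⟩
    · exact h.p_fresh k.2.1
    · exact h.p_fresh k.2.1
    · exact hc k
  exact h.isProofNet.correct.not_loop x v (hE.old _ _ _ hx hc ht hp hc ht hp).1

/-- Only correctness needs `hgood`. The other point to check is that no edge loses its source when
`c₁` and `c₂` are removed, and cuts have no conclusions. -/
theorem isProofNet_expand (h : N.IsExpandable c t p e f a b a' b' c₁ c₂)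
    (hgood : ∀ l, EdgeDart.IsWalk N.Joins c₁ l c₂ → (EdgeDart.srcs l).Nodup →
      c₂ ∉ EdgeDart.srcs l → EdgeDart.CuspFree N.portColor l →
      (∀ d ∈ l.head?, d.edge ≠ a) ∧ ∀ d ∈ l.getLast?, d.edge ≠ b) :
    (N.expand c t p e f a b a' b' c₁ c₂).IsProofNet := by
  have hN := h.isProofNet.typed
  refine ⟨h.isTyped, ?_, isCorrect_of_cuspAcyclic h.not_loop
    (h.isExpansion.cuspAcyclic (h.isProofNet.correct.cuspAcyclic hN) hgood)⟩
  intro x hx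
  rcases mem_edges.1 hx with rfl | rfl | hx
  · exact ⟨t, h.mem_nodes.2 (by simp), by simp [h.at_t.2.2]⟩
  · exact ⟨p, h.mem_nodes.2 (by simp), by simp [h.at_p.2.2]⟩
  · obtain ⟨v, hv, hxv⟩ := h.isProofNet.edge_is_concl x hx
    obtain ⟨k1, k2, k3⟩ := h.ne_of_mem hv
    refine ⟨v, h.mem_nodes.2 (.inr (.inr (.inr ⟨hv, ?_, ?_⟩))), ?_⟩
    · rintro rfl
      simp [hN.cut_concls hv h.c₁_label] at hxv
    · rintro rfl
      simp [hN.cut_concls hv h.c₂_label] at hxv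
    · rw [(at_old k1 k2 k3).2.2]
      exact hxv

end IsExpandable

end NetGraph

/-! ### Expansion of a partitioned net -/

namespace PartitionedNet

variable {α ν ε : Type*} {n : ℕ} {R : PartitionedNet α ν ε n}

theorem isConclusion_of_mem_prems (ht : R.net.IsTyped) {k : Fin n}
    (hk : R.partNodes k ⊆ R.net.nodes) {x : ε} {v : ν} (hx : x ∈ R.partEdges k)
    (hv : v ∈ R.net.nodes) (hvk : v ∉ R.partNodes k) (hxv : x ∈ R.net.prems v) :
    (R.part k).IsConclusion x :=
  ⟨hx, fun _ hw hxw => hvk (ht.prems_unique _ hv _ (hk hw) x hxv hxw ▸ hw)⟩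

theorem IsPartition.eq_of_mem_partEdges (hR : R.IsPartition) {k l : Fin n} {x : ε}
    (hk : x ∈ R.partEdges k) (hl : x ∈ R.partEdges l) : k = l := by
  by_contra h
  exact Finset.disjoint_left.1 (hR.partEdges_disjoint k l h) hk hl

/-- The sub-nets share no edge, so each premise of the cut determines the sub-net it comes from. -/
theorem IsPartition.eq_of_isCutBetween (hR : R.IsPartition) {v : ν} {i j k l : Fin n}
    (h : R.IsCutBetween v i j) (h' : R.IsCutBetween v k l) :
    (k = i ∧ l = j) ∨ (k = j ∧ l = i) := by
  obtain ⟨-, -, -, a, b, hp, ha, hb⟩ := h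
  obtain ⟨-, -, -, a', b', hp', ha', hb'⟩ := h'
  rcases List.perm_pair.1 (hp.symm.trans hp') with h | h
  · simp only [List.cons.injEq, and_true] at h
    obtain ⟨rfl, rfl⟩ := h
    exact .inl ⟨hR.eq_of_mem_partEdges ha'.1 ha.1, hR.eq_of_mem_partEdges hb'.1 hb.1⟩
  · simp only [List.cons.injEq, and_true] at h
    obtain ⟨rfl, rfl⟩ := h
    exact .inr ⟨hR.eq_of_mem_partEdges ha'.1 hb.1, hR.eq_of_mem_partEdges hb'.1 ha.1⟩

theorem mem_ite_singleton {A : Type*} {P : Prop} [Decidable P] {x y : A} :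
    x ∈ (if P then {y} else ∅ : Finset A) ↔ P ∧ x = y := by
  split_ifs with h <;> simp [h]

/-- The `⊗/⅋`-expansion of a partitioned net, with the new `⊗`-node in the `i`-th and the new
`⅋`-node in the `j`-th subgraph. -/
noncomputable def expand (R : PartitionedNet α ν ε n) (i j : Fin n) (c t p : ν)
    (e f a b a' b' : ε) (c₁ c₂ : ν) : PartitionedNet α ν ε n :=
  open Classical in
  { net := R.net.expand c t p e f a b a' b' c₁ c₂
    partNodes := fun k =>
      R.partNodes k ∪ ((if k = i then {t} else ∅) ∪ (if k = j then {p} else ∅))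
    partEdges := fun k =>
      R.partEdges k ∪ ((if k = i then {e} else ∅) ∪ (if k = j then {f} else ∅)) }

/-- Two cuts of a partitioned net between the `i`-th and the `j`-th subgraph, and fresh names, to
which an expansion can be applied. -/
structure IsExpandable (R : PartitionedNet α ν ε n) (i j : Fin n) (c t p : ν)
    (e f a b a' b' : ε) (c₁ c₂ : ν) : Prop where
  isPartition : R.IsPartition
  i_ne_j : i ≠ j
  net : R.net.IsExpandable c t p e f a b a' b' c₁ c₂
  c₁_not_mem : ∀ k, c₁ ∉ R.partNodes k
  c₂_not_mem : ∀ k, c₂ ∉ R.partNodes k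
  a_concl : (R.part i).IsConclusion a
  b_concl : (R.part i).IsConclusion b
  a'_concl : (R.part j).IsConclusion a'
  b'_concl : (R.part j).IsConclusion b'
  expand_isProofNet : (R.net.expand c t p e f a b a' b' c₁ c₂).IsProofNet

namespace IsExpandable

variable {i j : Fin n} {c t p : ν} {e f a b a' b' : ε} {c₁ c₂ : ν}

theorem mem_partNodes {k : Fin n} {v : ν} :
    v ∈ (R.expand i j c t p e f a b a' b' c₁ c₂).partNodes k ↔
      v ∈ R.partNodes k ∨ (k = i ∧ v = t) ∨ (k = j ∧ v = p) := by
  simp only [expand, Finset.mem_union, mem_ite_singleton]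

theorem mem_partEdges {k : Fin n} {x : ε} :
    x ∈ (R.expand i j c t p e f a b a' b' c₁ c₂).partEdges k ↔
      x ∈ R.partEdges k ∨ (k = i ∧ x = e) ∨ (k = j ∧ x = f) := by
  simp only [expand, Finset.mem_union, mem_ite_singleton]

theorem isCutBetween_c₁ (h : R.IsExpandable i j c t p e f a b a' b' c₁ c₂) :
    R.IsCutBetween c₁ i j :=
  ⟨h.net.c₁_mem, h.c₁_not_mem, h.net.c₁_label, a, a', h.net.c₁_prems, h.a_concl, h.a'_concl⟩

theorem isCutBetween_c₂ (h : R.IsExpandable i j c t p e f a b a' b' c₁ c₂) :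
    R.IsCutBetween c₂ i j :=
  ⟨h.net.c₂_mem, h.c₂_not_mem, h.net.c₂_label, b, b', h.net.c₂_prems, h.b_concl, h.b'_concl⟩

theorem expandsAt (h : R.IsExpandable i j c t p e f a b a' b' c₁ c₂) :
    R.ExpandsAt (R.expand i j c t p e f a b a' b' c₁ c₂) i j :=
  ⟨h.isPartition.isProofNet, h.expand_isProofNet, h.i_ne_j, c, t, p, e, f, a, b, a', b', c₁, c₂,
    h.net.tensorParStep, h.isCutBetween_c₁, h.isCutBetween_c₂, h.a_concl.1, h.b_concl.1,
    h.a'_concl.1, h.b'_concl.1, fun _ _ => mem_partNodes, fun _ _ => mem_partEdges⟩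

theorem partNodes_subset (h : R.IsExpandable i j c t p e f a b a' b' c₁ c₂) (k : Fin n) :
    (R.expand i j c t p e f a b a' b' c₁ c₂).partNodes k ⊆
      (R.expand i j c t p e f a b a' b' c₁ c₂).net.nodes := by
  intro v hv
  refine h.net.mem_nodes.2 ?_
  rcases mem_partNodes.1 hv with hv | ⟨-, rfl⟩ | ⟨-, rfl⟩
  · exact .inr (.inr (.inr ⟨h.isPartition.partNodes_subset k hv,
      fun hh => h.c₁_not_mem k (hh ▸ hv), fun hh => h.c₂_not_mem k (hh ▸ hv)⟩))
  · simp
  · simp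

theorem not_mem_partNodes {v : ν} (hv : ∀ k, v ∉ R.partNodes k) (ht : v ≠ t) (hp : v ≠ p) (k : Fin n) :
    v ∉ (R.expand i j c t p e f a b a' b' c₁ c₂).partNodes k := by
  rw [mem_partNodes]
  have := hv k
  tauto

theorem isCutBetween_old (h : R.IsExpandable i j c t p e f a b a' b' c₁ c₂) {v : ν} {k l : Fin n}
    (hv : R.IsCutBetween v k l) (h1 : v ≠ c₁) (h2 : v ≠ c₂) :
    (R.expand i j c t p e f a b a' b' c₁ c₂).IsCutBetween v k l := by
  obtain ⟨hv, hvk, hl, x, y, hp, hx, hy⟩ := hv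
  obtain ⟨n1, n2, n3⟩ := h.net.ne_of_mem hv
  obtain ⟨o1, o2, -⟩ := NetGraph.IsExpandable.at_old (N := R.net) (e := e) (f := f) (a := a)
    (b := b) (a' := a') (b' := b') (c₁ := c₁) (c₂ := c₂) n1 n2 n3
  have hM : v ∈ (R.expand i j c t p e f a b a' b' c₁ c₂).net.nodes :=
    h.net.mem_nodes.2 (.inr (.inr (.inr ⟨hv, h1, h2⟩)))
  have hnp := not_mem_partNodes (R := R) (i := i) (j := j) (c := c) (t := t) (p := p) (e := e) (f := f) (a := a)
    (b := b) (a' := a') (b' := b') (c₁ := c₁) (c₂ := c₂) hvk n2 n3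
  have hpM : ((R.expand i j c t p e f a b a' b' c₁ c₂).net.prems v).Perm [x, y] := by
    change ((R.net.expand c t p e f a b a' b' c₁ c₂).prems v).Perm [x, y]
    rwa [o2]
  exact ⟨hM, hnp, o1.trans hl, x, y, hpM,
    isConclusion_of_mem_prems h.net.isTyped (h.partNodes_subset k) (mem_partEdges.2 (.inl hx.1)) hM
      (hnp k) (hpM.mem_iff.2 (by simp)),
    isConclusion_of_mem_prems h.net.isTyped (h.partNodes_subset l) (mem_partEdges.2 (.inl hy.1)) hM
      (hnp l) (hpM.mem_iff.2 (by simp))⟩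

theorem isCutBetween_c (h : R.IsExpandable i j c t p e f a b a' b' c₁ c₂) :
    (R.expand i j c t p e f a b a' b' c₁ c₂).IsCutBetween c i j := by
  have hM : c ∈ (R.expand i j c t p e f a b a' b' c₁ c₂).net.nodes := h.net.mem_nodes.2 (by simp)
  have hnp := not_mem_partNodes (R := R) (i := i) (j := j) (c := c) (t := t) (p := p) (e := e) (f := f) (a := a)
    (b := b) (a' := a') (b' := b') (c₁ := c₁) (c₂ := c₂) (v := c)
    (fun k hk => h.net.c_fresh (h.isPartition.partNodes_subset k hk)) h.net.c_ne_t h.net.c_ne_p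
  have hpM : (R.expand i j c t p e f a b a' b' c₁ c₂).net.prems c = [e, f] :=
    NetGraph.IsExpandable.at_c.2.1
  exact ⟨hM, hnp, NetGraph.IsExpandable.at_c.1, e, f, by rw [hpM],
    isConclusion_of_mem_prems h.net.isTyped (h.partNodes_subset i) (mem_partEdges.2 (by simp)) hM
      (hnp i) (by simp [hpM]),
    isConclusion_of_mem_prems h.net.isTyped (h.partNodes_subset j) (mem_partEdges.2 (by simp)) hM
      (hnp j) (by simp [hpM])⟩

theorem isCutBetween_inv (h : R.IsExpandable i j c t p e f a b a' b' c₁ c₂) {v : ν} {k l : Fin n}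
    (hv : (R.expand i j c t p e f a b a' b' c₁ c₂).IsCutBetween v k l) :
    (v = c ∧ ((k = i ∧ l = j) ∨ (k = j ∧ l = i))) ∨ R.IsCutBetween v k l := by
  obtain ⟨hvM, hvk, hl, x, y, hp, hx, hy⟩ := hv
  have hRe : ∀ k, ∀ z ∈ R.partEdges k, z ≠ e ∧ z ≠ f := fun k z hz =>
    ⟨fun hh => h.net.e_fresh (hh ▸ h.isPartition.partEdges_subset k hz),
      fun hh => h.net.f_fresh (hh ▸ h.isPartition.partEdges_subset k hz)⟩
  have hei : ∀ k, e ∈ (R.expand i j c t p e f a b a' b' c₁ c₂).partEdges k → k = i := by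
    intro k hk
    rcases mem_partEdges.1 hk with hk | ⟨hk, -⟩ | ⟨-, hk⟩
    · exact absurd rfl (hRe k e hk).1
    · exact hk
    · exact absurd hk h.net.e_ne_f
  have hfj : ∀ k, f ∈ (R.expand i j c t p e f a b a' b' c₁ c₂).partEdges k → k = j := by
    intro k hk
    rcases mem_partEdges.1 hk with hk | ⟨-, hk⟩ | ⟨hk, -⟩
    · exact absurd rfl (hRe k f hk).2
    · exact absurd hk.symm h.net.e_ne_f
    · exact hk
  rcases h.net.mem_nodes.1 hvM with rfl | rfl | rfl | ⟨hv, -, -⟩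
  · left
    refine ⟨rfl, ?_⟩
    have hpM : (R.expand i j v t p e f a b a' b' c₁ c₂).net.prems v = [e, f] :=
      NetGraph.IsExpandable.at_c.2.1
    rw [hpM] at hp
    rcases List.perm_pair.1 hp with hh | hh
    · simp only [List.cons.injEq, and_true] at hh
      obtain ⟨rfl, rfl⟩ := hh
      exact .inl ⟨hei k hx.1, hfj l hy.1⟩
    · simp only [List.cons.injEq, and_true] at hh
      obtain ⟨rfl, rfl⟩ := hh
      exact .inr ⟨hfj k hx.1, hei l hy.1⟩
  · exact absurd (mem_partNodes.2 (by simp)) (hvk i)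
  · exact absurd (mem_partNodes.2 (by simp)) (hvk j)
  · right
    obtain ⟨n1, n2, n3⟩ := h.net.ne_of_mem hv
    obtain ⟨o1, o2, -⟩ := NetGraph.IsExpandable.at_old (N := R.net) (e := e) (f := f) (a := a)
      (b := b) (a' := a') (b' := b') (c₁ := c₁) (c₂ := c₂) n1 n2 n3
    have hp : (R.net.prems v).Perm [x, y] := by
      change ((R.net.expand c t p e f a b a' b' c₁ c₂).prems v).Perm [x, y] at hp
      rwa [o2] at hp
    have hnp : ∀ k, v ∉ R.partNodes k := fun k hk => hvk k (mem_partNodes.2 (.inl hk))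
    have hN := h.isPartition.isProofNet.typed
    have key : ∀ k z, z ∈ R.net.prems v →
        z ∈ (R.expand i j c t p e f a b a' b' c₁ c₂).partEdges k → (R.part k).IsConclusion z := by
      intro k z hz hzk
      have hzN := hN.prems_mem v hv z hz
      refine isConclusion_of_mem_prems hN (h.isPartition.partNodes_subset k) ?_ hv (hnp k) hz
      rcases mem_partEdges.1 hzk with hk | ⟨-, rfl⟩ | ⟨-, rfl⟩
      · exact hk
      · exact absurd hzN h.net.e_fresh
      · exact absurd hzN h.net.f_fresh
    exact ⟨hv, hnp, o1.symm.trans hl, x, y, hp, key k x (hp.mem_iff.2 (by simp)) hx.1,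
      key l y (hp.mem_iff.2 (by simp)) hy.1⟩

/-- The new cut `c` joins the same two sub-nets as `c₁` and `c₂`, and every other cut keeps its
premises and its sub-nets. -/
theorem skeleton_eq (h : R.IsExpandable i j c t p e f a b a' b' c₁ c₂) :
    (R.expand i j c t p e f a b a' b' c₁ c₂).skeleton = R.skeleton := by
  have hij : ∀ k l, (k = i ∧ l = j) ∨ (k = j ∧ l = i) → (∃ v, R.IsCutBetween v k l) ∧
      ∃ v, (R.expand i j c t p e f a b a' b' c₁ c₂).IsCutBetween v k l := by
    rintro k l (⟨rfl, rfl⟩ | ⟨rfl, rfl⟩)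
    · exact ⟨⟨c₁, h.isCutBetween_c₁⟩, c, h.isCutBetween_c⟩
    · exact ⟨⟨c₁, h.isCutBetween_c₁.symm⟩, c, h.isCutBetween_c.symm⟩
  ext k l
  refine and_congr_right fun hkl => ⟨?_, ?_⟩
  · rintro ⟨v, hv⟩
    rcases h.isCutBetween_inv hv with ⟨-, hh⟩ | hh
    · exact (hij k l hh).1
    · exact ⟨v, hh⟩
  · rintro ⟨v, hv⟩
    by_cases h1 : v = c₁
    · subst h1
      exact (hij k l (h.isPartition.eq_of_isCutBetween h.isCutBetween_c₁ hv)).2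
    by_cases h2 : v = c₂
    · subst h2
      exact (hij k l (h.isPartition.eq_of_isCutBetween h.isCutBetween_c₂ hv)).2
    exact ⟨v, h.isCutBetween_old hv h1 h2⟩

theorem part_isProofNet (h : R.IsExpandable i j c t p e f a b a' b' c₁ c₂) (k : Fin n) :
    ((R.expand i j c t p e f a b a' b' c₁ c₂).part k).IsProofNet := by
  have hM := h.net.isTyped
  have hk := h.isPartition.part_isProofNet k
  have hsub := h.partNodes_subset k
  have hold : ∀ v ∈ R.partNodes k, _ := fun v hv => NetGraph.IsExpandable.at_old (N := R.net)
    (e := e) (f := f) (a := a) (b := b) (a' := a') (b' := b') (c₁ := c₁) (c₂ := c₂)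
    (h.net.ne_of_mem (h.isPartition.partNodes_subset k hv)).1
    (h.net.ne_of_mem (h.isPartition.partNodes_subset k hv)).2.1
    (h.net.ne_of_mem (h.isPartition.partNodes_subset k hv)).2.2
  refine ⟨⟨?_, ?_, fun v hv => hM.typing v (hsub hv), fun v hv => hM.prems_nodup v (hsub hv),
    fun v hv => hM.concls_nodup v (hsub hv),
    fun v hv w hw => hM.prems_unique v (hsub hv) w (hsub hw),
    fun v hv w hw => hM.concls_unique v (hsub hv) w (hsub hw)⟩, ?_,
    -- The enlarged sub-nets are correct simply as subgraphs of the expanded net.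
    h.expand_isProofNet.correct.restrict hM _ hsub⟩
  · intro v hv x hx
    change x ∈ (R.net.expand c t p e f a b a' b' c₁ c₂).prems v at hx
    change v ∈ (R.expand i j c t p e f a b a' b' c₁ c₂).partNodes k at hv
    change x ∈ (R.expand i j c t p e f a b a' b' c₁ c₂).partEdges k
    rw [mem_partEdges]
    rcases mem_partNodes.1 hv with hv | ⟨rfl, rfl⟩ | ⟨rfl, rfl⟩
    · rw [(hold v hv).2.1] at hx
      exact .inl (hk.typed.prems_mem v hv x hx)
    · rw [h.net.at_t.2.1] at hx
      simp only [List.mem_cons, List.not_mem_nil, or_false] at hx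
      rcases hx with rfl | rfl
      · exact .inl h.a_concl.1
      · exact .inl h.b_concl.1
    · rw [h.net.at_p.2.1] at hx
      simp only [List.mem_cons, List.not_mem_nil, or_false] at hx
      rcases hx with rfl | rfl
      · exact .inl h.a'_concl.1
      · exact .inl h.b'_concl.1
  · intro v hv x hx
    change x ∈ (R.net.expand c t p e f a b a' b' c₁ c₂).concls v at hx
    change v ∈ (R.expand i j c t p e f a b a' b' c₁ c₂).partNodes k at hv
    change x ∈ (R.expand i j c t p e f a b a' b' c₁ c₂).partEdges k
    rw [mem_partEdges]
    rcases mem_partNodes.1 hv with hv | ⟨rfl, rfl⟩ | ⟨rfl, rfl⟩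
    · rw [(hold v hv).2.2] at hx
      exact .inl (hk.typed.concls_mem v hv x hx)
    · rw [h.net.at_t.2.2] at hx
      exact .inr (.inl ⟨rfl, by simpa using hx⟩)
    · rw [h.net.at_p.2.2] at hx
      exact .inr (.inr ⟨rfl, by simpa using hx⟩)
  · intro x hx
    change x ∈ (R.expand i j c t p e f a b a' b' c₁ c₂).partEdges k at hx
    change ∃ v ∈ (R.expand i j c t p e f a b a' b' c₁ c₂).partNodes k,
      x ∈ (R.net.expand c t p e f a b a' b' c₁ c₂).concls v
    simp only [mem_partNodes]
    rcases mem_partEdges.1 hx with hx | ⟨rfl, rfl⟩ | ⟨rfl, rfl⟩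
    · obtain ⟨v, hv, hxv⟩ := hk.edge_is_concl x hx
      refine ⟨v, .inl hv, ?_⟩
      rw [(hold v hv).2.2]
      exact hxv
    · exact ⟨t, by simp, by simp [h.net.at_t.2.2]⟩
    · exact ⟨p, by simp, by simp [h.net.at_p.2.2]⟩

theorem expand_isPartition (h : R.IsExpandable i j c t p e f a b a' b' c₁ c₂) :
    (R.expand i j c t p e f a b a' b' c₁ c₂).IsPartition := by
  have hN : ∀ k, ∀ v ∈ R.partNodes k, v ≠ t ∧ v ≠ p := fun k v hv =>
    (h.net.ne_of_mem (h.isPartition.partNodes_subset k hv)).2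
  have hE : ∀ k, ∀ x ∈ R.partEdges k, x ≠ e ∧ x ≠ f := fun k x hx =>
    ⟨fun hh => h.net.e_fresh (hh ▸ h.isPartition.partEdges_subset k hx),
      fun hh => h.net.f_fresh (hh ▸ h.isPartition.partEdges_subset k hx)⟩
  have htp := h.net.t_ne_p
  have hef := h.net.e_ne_f
  refine ⟨h.expand_isProofNet, h.partNodes_subset, ?_, h.part_isProofNet, ?_, ?_, ?_, ?_⟩
  · intro k x hx
    refine NetGraph.IsExpandable.mem_edges.2 ?_
    rcases mem_partEdges.1 hx with hx | ⟨-, rfl⟩ | ⟨-, rfl⟩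
    · exact .inr (.inr (h.isPartition.partEdges_subset k hx))
    · simp
    · simp
  · intro k l hkl
    rw [Finset.disjoint_left]
    intro v hk hl
    have hd : v ∈ R.partNodes k → v ∉ R.partNodes l := fun hh =>
      Finset.disjoint_left.1 (h.isPartition.partNodes_disjoint k l hkl) hh
    rw [mem_partNodes] at hk hl
    have h1 := hN k v
    have h2 := hN l v
    grind
  · intro k l hkl
    rw [Finset.disjoint_left]
    intro x hk hl
    have hd : x ∈ R.partEdges k → x ∉ R.partEdges l := fun hh =>
      Finset.disjoint_left.1 (h.isPartition.partEdges_disjoint k l hkl) hh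
    rw [mem_partEdges] at hk hl
    have h1 := hE k x
    have h2 := hE l x
    grind
  · intro x hx
    rcases NetGraph.IsExpandable.mem_edges.1 hx with rfl | rfl | hx
    · exact ⟨i, mem_partEdges.2 (by simp)⟩
    · exact ⟨j, mem_partEdges.2 (by simp)⟩
    · obtain ⟨k, hk⟩ := h.isPartition.edges_covered x hx
      exact ⟨k, mem_partEdges.2 (.inl hk)⟩
  · intro v hv
    rcases h.net.mem_nodes.1 hv with rfl | rfl | rfl | ⟨hv, h1, h2⟩
    · exact .inr ⟨i, j, h.i_ne_j, h.isCutBetween_c⟩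
    · exact .inl ⟨i, mem_partNodes.2 (by simp)⟩
    · exact .inl ⟨j, mem_partNodes.2 (by simp)⟩
    · rcases h.isPartition.nodes_covered v hv with ⟨k, hk⟩ | ⟨k, l, hkl, hc⟩
      · exact .inl ⟨k, mem_partNodes.2 (.inl hk)⟩
      · exact .inr ⟨k, l, hkl, h.isCutBetween_old hc h1 h2⟩

end IsExpandable

/-! ### Choice of the cuts and termination -/

open Classical in
/-- The number of nodes outside the chosen subgraphs. -/
noncomputable def numCuts (R : PartitionedNet α ν ε n) : ℕ :=
  (R.net.nodes.filter fun v => ∀ k, v ∉ R.partNodes k).card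

/-- Two cuts give way to a single one, while the new `⊗`- and `⅋`-nodes are absorbed by sub-nets. -/
theorem IsExpandable.numCuts_lt {i j : Fin n} {c t p : ν} {e f a b a' b' : ε} {c₁ c₂ : ν}
    (h : R.IsExpandable i j c t p e f a b a' b' c₁ c₂) :
    (R.expand i j c t p e f a b a' b' c₁ c₂).numCuts < R.numCuts := by
  classical
  set F := R.net.nodes.filter fun v => ∀ k, v ∉ R.partNodes k with hF
  have h1 : c₁ ∈ F := Finset.mem_filter.2 ⟨h.net.c₁_mem, h.c₁_not_mem⟩
  have h2 : c₂ ∈ F.erase c₁ :=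
    Finset.mem_erase.2 ⟨h.net.c₁_ne_c₂.symm, Finset.mem_filter.2 ⟨h.net.c₂_mem, h.c₂_not_mem⟩⟩
  have hsub : ((R.expand i j c t p e f a b a' b' c₁ c₂).net.nodes.filter fun v =>
      ∀ k, v ∉ (R.expand i j c t p e f a b a' b' c₁ c₂).partNodes k) ⊆
      insert c ((F.erase c₁).erase c₂) := by
    intro v hv
    obtain ⟨hv, hvk⟩ := Finset.mem_filter.1 hv
    rcases h.net.mem_nodes.1 hv with rfl | rfl | rfl | ⟨hv, k1, k2⟩
    · simp
    · exact absurd (mem_partNodes.2 (by simp)) (hvk i)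
    · exact absurd (mem_partNodes.2 (by simp)) (hvk j)
    · refine Finset.mem_insert_of_mem (Finset.mem_erase.2 ⟨k2, Finset.mem_erase.2 ⟨k1,
        Finset.mem_filter.2 ⟨hv, fun k hk => hvk k (mem_partNodes.2 (.inl hk))⟩⟩⟩)
  have e1 := Finset.card_erase_add_one h1
  have e2 := Finset.card_erase_add_one h2
  have e3 := (Finset.card_le_card hsub).trans (Finset.card_insert_le _ _)
  have e4 : R.numCuts = F.card := by
    unfold numCuts
    rw [hF]
  rw [e4]
  refine lt_of_le_of_lt (le_trans (le_of_eq ?_) e3) (by omega)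
  unfold numCuts
  congr

/-- Two cuts between the `i`-th and the `j`-th sub-net of a cut-net can be expanded, with the
`⊗`-node in the `i`-th one, if no cusp-free path between them ends in the `i`-th sub-net. -/
theorem IsCutNet.exists_expansion [Infinite ν] [Infinite ε] (hR : R.IsCutNet) {i j : Fin n}
    (hij : i ≠ j) {c₁ c₂ : ν} (hc : c₁ ≠ c₂) (h₁ : R.IsCutBetween c₁ i j)
    (h₂ : R.IsCutBetween c₂ i j)
    (hgood : ∀ l, EdgeDart.IsWalk R.net.Joins c₁ l c₂ → (EdgeDart.srcs l).Nodup →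
      c₂ ∉ EdgeDart.srcs l → EdgeDart.CuspFree R.net.portColor l →
      (∀ d ∈ l.head?, d.edge ∉ R.partEdges i) ∧ ∀ d ∈ l.getLast?, d.edge ∉ R.partEdges i) :
    ∃ R', R.ExpandsAt R' i j ∧ R'.IsCutNet ∧ R'.numCuts < R.numCuts := by
  classical
  obtain ⟨hm1, hk1, hl1, a, a', hp1, ha, ha'⟩ := h₁
  obtain ⟨hm2, hk2, hl2, b, b', hp2, hb, hb'⟩ := h₂
  obtain ⟨c, hcf⟩ := Infinite.exists_notMem_finset R.net.nodes
  obtain ⟨t, htf⟩ := Infinite.exists_notMem_finset (insert c R.net.nodes)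
  obtain ⟨p, hpf⟩ := Infinite.exists_notMem_finset (insert t (insert c R.net.nodes))
  obtain ⟨e, hef⟩ := Infinite.exists_notMem_finset R.net.edges
  obtain ⟨f, hff⟩ := Infinite.exists_notMem_finset (insert e R.net.edges)
  simp only [Finset.mem_insert, not_or] at htf hpf hff
  have hE : R.net.IsExpandable c t p e f a b a' b' c₁ c₂ :=
    ⟨hR.isPartition.isProofNet, hcf, htf.2, hpf.2.2, Ne.symm htf.1, Ne.symm hpf.2.1, Ne.symm hpf.1,
      hef, hff.2, Ne.symm hff.1, hm1, hm2, hc, hl1, hl2, hp1, hp2⟩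
  have hM := hE.isProofNet_expand fun l k1 k2 k3 k4 =>
    ⟨fun d hd hh => (hgood l k1 k2 k3 k4).1 d hd (hh ▸ ha.1),
      fun d hd hh => (hgood l k1 k2 k3 k4).2 d hd (hh ▸ hb.1)⟩
  have hX : R.IsExpandable i j c t p e f a b a' b' c₁ c₂ :=
    ⟨hR.isPartition, hij, hE, hk1, hk2, ha, hb, ha', hb', hM⟩
  exact ⟨_, hX.expandsAt, ⟨hX.expand_isPartition, hX.skeleton_eq ▸ hR.skeleton_isTree⟩,
    hX.numCuts_lt⟩

/-- In a cut-net, some expansion is possible on the cuts between any two sub-nets which have at least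
two cuts between them. -/
theorem IsCutNet.exists_expands [Infinite ν] [Infinite ε] (hR : R.IsCutNet) {i j : Fin n}
    (hij : i ≠ j) (hcuts : ¬ {c : ν | R.IsCutBetween c i j}.Subsingleton) :
    ∃ R', R.Expands R' ∧ R'.IsCutNet ∧ R'.numCuts < R.numCuts := by
  classical
  have hP := hR.isPartition
  have hN := hP.isProofNet.typed
  rw [Set.not_subsingleton_iff] at hcuts
  obtain ⟨k₁, hk₁, k₂, hk₂, hk⟩ := hcuts
  have hadj : R.skeleton.Adj i j := ⟨hij, k₁, hk₁⟩
  set H := R.skeleton.deleteEdges {s(i, j)} with hH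
  -- In a tree every edge is a bridge; this is where the acyclicity of the skeleton enters.
  have hbr : ¬ H.Reachable i j := by
    have := SimpleGraph.isAcyclic_iff_forall_adj_isBridge.1 hR.skeleton_isTree.isAcyclic hadj
    exact SimpleGraph.isBridge_iff.1 this
  -- The side of an edge: whether its sub-net stays connected to the `i`-th one once the skeleton
  -- edge between `i` and `j` is deleted.
  let S : ε → Prop := fun x => ∃ k, x ∈ R.partEdges k ∧ H.Reachable i k
  have hSk : ∀ k x, x ∈ R.partEdges k → (S x ↔ H.Reachable i k) := fun k x hx =>
    ⟨fun ⟨l, hl, hr⟩ => hP.eq_of_mem_partEdges hl hx ▸ hr, fun hr => ⟨k, hx, hr⟩⟩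
  let K : Set ν := {c | R.IsCutBetween c i j}
  have hinc : ∀ {x u w}, R.net.Joins x u w → x ∈ R.net.prems u ∨ x ∈ R.net.concls u := by
    rintro x u w ⟨-, -, hx | hx⟩
    · exact .inr hx.1
    · exact .inl hx.2
  -- Only cuts between `i` and `j` have edges on both sides: the edges at a node of a sub-net all
  -- belong to it, and any other cut joins two sub-nets adjacent in `H`.
  have hS : ∀ x y u w w', R.net.Joins x u w → R.net.Joins y u w' → u ∉ K → S x = S y := by
    intro x y u w w' hx hy huK
    have hx' := hinc hx
    have hy' := hinc hy
    rcases hP.nodes_covered u hx.1 with ⟨k, hku⟩ | ⟨k, l, hkl, hcut⟩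
    · have ht := (hP.part_isProofNet k).typed
      have key : ∀ z, z ∈ R.net.prems u ∨ z ∈ R.net.concls u → z ∈ R.partEdges k := by
        rintro z (hz | hz)
        · exact ht.prems_mem u hku z hz
        · exact ht.concls_mem u hku z hz
      rw [hSk k x (key x hx'), hSk k y (key y hy')]
    · have hne : s(k, l) ≠ s(i, j) := by
        intro hh
        rcases Sym2.eq_iff.1 hh with ⟨rfl, rfl⟩ | ⟨rfl, rfl⟩
        · exact huK hcut
        · exact huK hcut.symm
      have hHadj : H.Adj k l := by
        rw [hH, SimpleGraph.deleteEdges_adj]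
        exact ⟨⟨hkl, u, hcut⟩, by simpa using hne⟩
      have hreach : H.Reachable i k ↔ H.Reachable i l :=
        ⟨fun h => h.trans hHadj.reachable, fun h => h.trans hHadj.symm.reachable⟩
      obtain ⟨hu, -, hl, a, b, hp, ha, hb⟩ := hcut
      have key : ∀ z, z ∈ R.net.prems u ∨ z ∈ R.net.concls u → (S z ↔ H.Reachable i k) := by
        rintro z (hz | hz)
        · have hz := hp.mem_iff.1 hz
          simp only [List.mem_cons, List.not_mem_nil, or_false] at hz
          rcases hz with rfl | rfl
          · exact hSk k z ha.1
          · exact (hSk l z hb.1).trans hreach.symm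
        · rw [hN.cut_concls hu hl] at hz
          simp at hz
      rw [key x hx', key y hy']
  -- Distinct edges of the same colour meet at a `par`- or contraction-node, which is not a cut and
  -- so not in `K`.
  have hcol : ∀ x y u w w', R.net.Joins x u w → R.net.Joins y u w' →
      R.net.portColor u x = R.net.portColor u y → S x = S y := by
    intro x y u w w' hx hy hxy
    rcases NetGraph.portColor_eq_iff.1 hxy with rfl | ⟨hl, -⟩
    · rfl
    · refine hS x y u w w' hx hy fun huK => ?_
      rw [huK.2.2.1] at hl
      simp at hl
  obtain ⟨c₁, -, c₂, -, hc₁, hc₂, hc, s, hs⟩ := EdgeDart.exists_pair S K NetGraph.joins_symm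
    (hP.isProofNet.correct.cuspAcyclic hN) hS hcol True R.net.nodes
    ⟨k₁, hk₁.1, k₂, hk₂.1, hk₁, hk₂, hk⟩
  have hs' : ∀ l, EdgeDart.IsWalk R.net.Joins c₁ l c₂ → (EdgeDart.srcs l).Nodup →
      c₂ ∉ EdgeDart.srcs l → EdgeDart.CuspFree R.net.portColor l →
      (∀ d ∈ l.head?, S d.edge = s) ∧ ∀ d ∈ l.getLast?, S d.edge = s := fun l hl =>
    hs l (hl.mono fun d _ h => ⟨h.1, h.2.1, h⟩)
  -- If the paths begin and end on the side of `i`, the `⊗`-node goes into the `j`-th sub-net, whose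
  -- edges they then avoid at both ends; otherwise it goes into the `i`-th.
  by_cases hst : s
  · obtain ⟨R', h1, h2, h3⟩ := hR.exists_expansion hij.symm hc hc₁.symm hc₂.symm
      fun l k1 k2 k3 k4 => by
        obtain ⟨m1, m2⟩ := hs' l k1 k2 k3 k4
        exact ⟨fun d hd hh => hbr ((hSk j _ hh).1 ((m1 d hd).symm ▸ hst)),
          fun d hd hh => hbr ((hSk j _ hh).1 ((m2 d hd).symm ▸ hst))⟩
    exact ⟨R', ⟨j, i, h1⟩, h2, h3⟩
  · obtain ⟨R', h1, h2, h3⟩ := hR.exists_expansion hij hc hc₁ hc₂ fun l k1 k2 k3 k4 => by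
        obtain ⟨m1, m2⟩ := hs' l k1 k2 k3 k4
        exact ⟨fun d hd hh => hst (m1 d hd ▸ (hSk i _ hh).2 (.refl i)),
          fun d hd hh => hst (m2 d hd ▸ (hSk i _ hh).2 (.refl i))⟩
    exact ⟨R', ⟨i, j, h1⟩, h2, h3⟩

end PartitionedNet

theorem mainTheorem3 {α ν ε : Type*} [Infinite ν] [Infinite ε] {n : ℕ}
    (R : PartitionedNet α ν ε n) (hR : R.IsCutNet) :
    ∃ R' : PartitionedNet α ν ε n,
      Relation.ReflTransGen PartitionedNet.Expands R R' ∧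
      R'.IsCutNet ∧
      ∀ i j : Fin n, i ≠ j → {c : ν | R'.IsCutBetween c i j}.Subsingleton := by
  -- Induction on the number of cuts outside the sub-nets, which every expansion lowers.
  induction hm : R.numCuts using Nat.strong_induction_on generalizing R with
  | _ m ih =>
  by_cases h : ∀ i j : Fin n, i ≠ j → {c : ν | R.IsCutBetween c i j}.Subsingleton
  · exact ⟨R, .refl, hR, h⟩
  · push Not at h
    obtain ⟨i, j, hij, hcuts⟩ := h
    obtain ⟨R₁, hR₁, hcut₁, hlt⟩ := hR.exists_expands hij (Set.not_subsingleton_iff.2 hcuts)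
    obtain ⟨R', hR', hcut', hsub⟩ := ih _ (hm ▸ hlt) R₁ hcut₁ rfl
    exact ⟨R', .head hR₁ hR', hcut', hsub⟩
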